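/- Let $\Sigma$ be a compact oriented surface, let $B\subset\partial\Sigma$ be a finite set of points, and let $T$ be a connected, alternating tangle diagram on $(\Sigma,B)$ with a checkerboard coloring (a black/white coloring of the regions of $\Sigma\setminus T$ in which regions abutting along an edge of $T$ have different colors). Choose an orientation of the tangle, and let $n_+$ be the number of positive crossings. Let $\mathbb F_T$ be the field of rational functions over $\mathbb Z/2\mathbb Z$ in one variable $x_f$ for each edge $f$ of $T$. For a set $S$ of crossings let $r_S$ be the resolution of $T$ in which the crossings in $S$ are $1$-resolved and the other ones $0$-resolved (the $0$-resolution joins the two regions swept out by rotating the overcrossing strand counterclockwise). A circle in $\Sigma$ is contractible if it bounds a disc. A state $r$ is a resolution $r_S$ with a sign $\pm1$ on each noncontractible circle; put $|r|=\#S$. A glyph is a family of disjoint properly embedded arcs and noncontractible circles in $\Sigma$, the boundaries of the arcs exhausting $B$ and each circle labeled with an integer, up to isotopy relative to $\partial\Sigma$ and to erasing or introducing circles labeled $0$. A colored glyph $b^c$ is a glyph $b$ with a black/white coloring of its regions such that regions abutting an arc or a circle with an odd label have different colors and regions abutting a circle with an even label have the same color (colorings are carried along by isotopies and by erasures and introductions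 of circles). The glyph of a state is obtained by erasing the contractible circles and replacing each collection of circles that pairwise cobound annuli by one circle labeled with the sum of their signs, each annulus between two circles so merged being absorbed into a neighboring region; for a state without contractible circles the coloring of $T$ thereby induces a coloring of its glyph. Let $CT_i(T,b^c)$ be the $\mathbb F_T$-vector space whose basis is the set of states $r$ without contractible circles, with $|r|=i$ and with colored glyph $b^c$, and let $\partial_n: CT_i(T,b^c)\to CT_{i+2}(T,b^c)$, $\partial_n r=\sum_{r'}\langle r,r'\rangle r'$. Here $\langle r,r'\rangle=\sum 1/[C]$, where the sum runs over the states $t$ with the same glyph as $r$ and $r'$ such that $t$ is obtained from $r$, and $r'$ from $t$, by changing one crossing from its $0$- to its $1$-resolution while keeping the signs of all circles that do not pass through that crossing, and over the contractible circles $C$ of $t$; and $[C]$ is the sum of the variables $x_f$ of the edges $f$ on $C$. Let $\underline{HT}_*(\mathcal T,b^c)$ be the homology of the shifted complex $CT_*(T,b^c)[-n_+]$, whose group in degree $j$ is $CT_{j+n_+}(T,b^c)$. Then for each colored glyph $b^c$ the complex $CT_*(T,b^c)$ is supported in a single homological grading: there is an integer $i$ with $CT_j(T,b^c)=0$ for all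 $j\neq i$. Consequently $\partial_n=0$, $\underline{HT}_j(\mathcal T,b^c)\cong CT_{j+n_+}(T,b^c)$ for all $j$, and $\underline{HT}_j(\mathcal T,b^c)=0$ for $j\neq i-n_+$. -/

import Mathlib

/-!
Compact oriented surfaces, curve systems on them and isotopy are treated piecewise linearly.

A compact oriented surface is given as a finite collection of oriented polygons whose sides are
glued in pairs by orientation reversing maps; the unpaired sides form the boundary.  Curves are
subcomplexes of the 1-skeleton; isotopies are generated by pushing an arc of the curve across
one closed polygonal disc, where the cell structure may be subdivided arbitrarily.
-/

noncomputable section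

open Relation

/-- A compact oriented surface `Σ` with a cell structure, together with a finite set `B` of points
of its boundary.  A *dart* is a side of one of the polygons, oriented so that the polygon lies on
its left.  `next d` is the side that follows `d` counterclockwise around its polygon; `opp d` is
the side glued to `d`, and `opp d = d` means that `d` lies on the boundary of `Σ`.  Every boundary
vertex is the initial point of exactly one boundary dart; `marked` is the set of the boundary darts
that start at the points of `B`. -/
structure MarkedSurface where
  Dart : Type
  [fintype : Fintype Dart]
  [decEq : DecidableEq Dart]
  next : Equiv.Perm Dart
  opp : Equiv.Perm Dart
  opp_opp : ∀ d, opp (opp d) = d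
  marked : Set Dart
  opp_marked : ∀ d ∈ marked, opp d = d

attribute [instance] MarkedSurface.fintype MarkedSurface.decEq

namespace MarkedSurface

variable (X : MarkedSurface)

/-- One step counterclockwise from the dart `d` to the next dart with the same initial vertex. -/
def VertexStep (d d' : X.Dart) : Prop := X.opp d ≠ d ∧ d' = X.next (X.opp d)

/-- `d` and `d'` start at the same vertex of the surface. -/
def SameVertex : X.Dart → X.Dart → Prop := EqvGen X.VertexStep

/-- The initial vertex of `d` lies on the boundary of the surface. -/
def OnBoundary (d : X.Dart) : Prop := ∃ b, X.opp b = b ∧ X.SameVertex d b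

/-- The valency, in the set of edges `C`, of the initial vertex of `d`. -/
def degree (C : Set X.Dart) (d : X.Dart) : ℕ := {d' | X.SameVertex d d' ∧ d' ∈ C}.ncard

/-- `C` (a set of edges, each represented by both of its darts) is a compact 1-manifold properly
embedded in the surface, whose boundary is exactly `B`. -/
structure IsCurve (C : Set X.Dart) : Prop where
  opp_mem : ∀ d ∈ C, X.opp d ∈ C
  opp_ne : ∀ d ∈ C, X.opp d ≠ d
  interior : ∀ d, ¬ X.OnBoundary d → X.degree C d = 0 ∨ X.degree C d = 2
  marked : ∀ b ∈ X.marked, X.degree C b = 1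
  unmarked : ∀ b, X.opp b = b → b ∉ X.marked → X.degree C b = 0

/-- `d` and `d'` lie on the same component of `C`. -/
def SameComp (C : Set X.Dart) : X.Dart → X.Dart → Prop :=
  EqvGen fun d d' => d ∈ C ∧ d' ∈ C ∧ (d' = X.opp d ∨ X.SameVertex d d')

/-- The component of `C` that contains `d`. -/
def comp (C : Set X.Dart) (d : X.Dart) : Set X.Dart := {d' | X.SameComp C d d'}

/-- `d` lies on an arc of `C`, that is, on a component that ends on `B`. -/
def OnArc (C : Set X.Dart) (d : X.Dart) : Prop :=
  d ∈ C ∧ ∃ b ∈ X.marked, ∃ d' ∈ C, X.SameComp C d d' ∧ X.SameVertex d' b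

/-- `d` lies on a circle of `C`. -/
def OnCircle (C : Set X.Dart) (d : X.Dart) : Prop := d ∈ C ∧ ¬ X.OnArc C d

/-- The union of closed faces `F` (given by the darts on its faces) is a connected subsurface,
disjoint from the edges of the boundary of `Σ`, whose own boundary is `K`. -/
structure IsSubsurface (F K : Set X.Dart) : Prop where
  nonempty : F.Nonempty
  next_mem : ∀ d ∈ F, X.next d ∈ F
  opp_ne : ∀ d ∈ F, X.opp d ≠ d
  frontier : ∀ d ∈ F, (X.opp d ∉ F ↔ d ∈ K)
  one_side : ∀ d ∈ K, d ∈ F ∨ X.opp d ∈ F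
  connected : ∀ d ∈ F, ∀ d' ∈ F,
    EqvGen (fun a b => a ∈ F ∧ b ∈ F ∧ (b = X.next a ∨ b = X.opp a)) d d'

/-- The Euler characteristic (vertices minus edges plus faces) of the union of closed faces `F`. -/
def euler (F : Set X.Dart) : ℤ :=
  ((Quot.mk X.SameVertex '' F).ncard : ℤ)
    - ((fun d => s(d, X.opp d)) '' F).ncard
    + (Quot.mk X.next.SameCycle '' F).ncard

/-- `F` is a closed disc with boundary circle `K`: among the compact connected surfaces whose
boundary is one circle, the disc is the one of Euler characteristic `1`. -/
def IsDisc (F K : Set X.Dart) : Prop := X.IsSubsurface F K ∧ X.euler F = 1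

/-- `F` is an annulus whose boundary consists of the two circles `K` and `L`: among the compact
connected oriented surfaces whose boundary is two circles, the annulus is the one of Euler
characteristic `0`. -/
def IsAnnulus (F K L : Set X.Dart) : Prop := X.IsSubsurface F (K ∪ L) ∧ X.euler F = 0

/-- `d` lies on a contractible circle of `C`: one that bounds a disc in the surface. -/
def Contractible (C : Set X.Dart) (d : X.Dart) : Prop :=
  X.OnCircle C d ∧ ∃ F, X.IsDisc F (X.comp C d)

/-- Subdivision of the interior edge `{e, opp e}` by one new vertex.  The dart `e` becomes the
dart `inl e` followed by `inr true`, and `opp e` becomes `inl (opp e)` followed by `inr false`. -/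
def splitEdge (e : X.Dart) (he : X.opp e ≠ e) : MarkedSurface where
  Dart := X.Dart ⊕ Bool
  next := Equiv.sumCongr X.next (Equiv.refl Bool)
    * Equiv.swap (Sum.inl e) (Sum.inr true) * Equiv.swap (Sum.inl (X.opp e)) (Sum.inr false)
  opp := Equiv.swap (Sum.inl (X.opp e)) (Sum.inr false)
    * Equiv.sumCongr X.opp Equiv.boolNot * Equiv.swap (Sum.inl (X.opp e)) (Sum.inr false)
  opp_opp := by
    have h : ∀ x : X.Dart ⊕ Bool,
        Equiv.sumCongr X.opp Equiv.boolNot (Equiv.sumCongr X.opp Equiv.boolNot x) = x := by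
      rintro (d | d) <;> simp [X.opp_opp]
    intro d
    rw [Equiv.Perm.mul_apply, Equiv.Perm.mul_apply, Equiv.Perm.mul_apply, Equiv.Perm.mul_apply,
      Equiv.swap_apply_self, h, Equiv.swap_apply_self]
  marked := Sum.inl '' X.marked
  opp_marked := by
    rintro _ ⟨d, hd, rfl⟩
    have h := X.opp_marked d hd
    have h2 : d ≠ X.opp e := by
      rintro rfl
      exact he (by rw [X.opp_opp] at h; exact h.symm)
    have h3 : (Sum.inl d : X.Dart ⊕ Bool) ≠ Sum.inl (X.opp e) := by simpa using h2
    have h4 : (Sum.inl d : X.Dart ⊕ Bool) ≠ Sum.inr false := by simp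
    simp [Equiv.swap_apply_of_ne_of_ne h3 h4, h]

/-- Subdivision of the boundary edge `e` by one new vertex: `e` becomes `inl e` followed by
`inr ()`. -/
def splitBoundary (e : X.Dart) : MarkedSurface where
  Dart := X.Dart ⊕ Unit
  next := Equiv.sumCongr X.next (Equiv.refl Unit) * Equiv.swap (Sum.inl e) (Sum.inr ())
  opp := Equiv.sumCongr X.opp (Equiv.refl Unit)
  opp_opp := by
    rintro (d | d) <;> simp [X.opp_opp]
  marked := Sum.inl '' X.marked
  opp_marked := by
    rintro _ ⟨d, hd, rfl⟩
    simp [X.opp_marked d hd]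

/-- Subdivision of a face by a diagonal, for two different darts `a`, `b` of that face.  The new
edge runs from the initial vertex of `a` to that of `b` as `inr true`, which is followed by `b`,
and back as `inr false`, which is followed by `a`. -/
def splitFace (a b : X.Dart) : MarkedSurface where
  Dart := X.Dart ⊕ Bool
  next := List.formPerm [Sum.inl a, Sum.inr true, Sum.inl b, Sum.inr false]
    * Equiv.sumCongr X.next (Equiv.refl Bool)
  opp := Equiv.sumCongr X.opp Equiv.boolNot
  opp_opp := by
    rintro (d | d) <;> simp [X.opp_opp]
  marked := Sum.inl '' X.marked
  opp_marked := by
    rintro _ ⟨d, hd, rfl⟩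
    simp [X.opp_marked d hd]

end MarkedSurface

/-! ### Labelled and coloured curve systems, and glyphs -/

/-- A set of edges with integers attached to them (which are to be `0` off the circles). -/
structure Config (X : MarkedSurface) where
  curve : Set X.Dart
  label : X.Dart → ℤ

/-- A labelled curve system together with a colouring of the faces; `black` is the set of the
darts that lie on black faces. -/
structure ColConfig (X : MarkedSurface) extends Config X where
  black : Set X.Dart

namespace Config

variable {X : MarkedSurface}

/-- The configurations that define glyphs: disjoint properly embedded noncontractible circles, each
labelled with an integer, and arcs whose boundaries exhaust `B`. -/
structure Valid (g : Config X) : Prop where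
  isCurve : X.IsCurve g.curve
  label_eq : ∀ d d', X.SameComp g.curve d d' → g.label d = g.label d'
  label_zero : ∀ d, ¬ X.OnCircle g.curve d → g.label d = 0
  noncontractible : ∀ d, ¬ X.Contractible g.curve d

/-- The closed face `next^[i] s`, `i < n`, is an embedded polygon `P` with `n` sides, the curve
meets it exactly in the path formed by its first `k` sides, and `g'` results from `g` when that
path is pushed across `P` to the path formed by the remaining `n - k` sides. -/
structure Push (g g' : Config X) (s : X.Dart) (k n : ℕ) (P : Set X.Dart) : Prop where
  face : P = {d | ∃ i < n, d = X.next^[i] s}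
  closed : X.next^[n] s = s
  embedded : ∀ i < n, ∀ j < n, X.SameVertex (X.next^[i] s) (X.next^[j] s) → i = j
  opp_notMem : ∀ d ∈ P, X.opp d ∉ P
  k_pos : 0 < k
  k_lt : k < n
  on_curve : ∀ i < k, X.next^[i] s ∈ g.curve
  off_curve : ∀ i, k ≤ i → i < n → X.next^[i] s ∉ g.curve
  off_vertex : ∀ i, k < i → i < n → ∀ d, X.SameVertex (X.next^[i] s) d → d ∉ g.curve
  curve_eq : g'.curve = symmDiff g.curve {d | d ∈ P ∨ X.opp d ∈ P}
  label_old : ∀ d, (d ∈ P ∨ X.opp d ∈ P) → d ∈ g.curve → g'.label d = 0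
  label_new : ∀ d, (d ∈ P ∨ X.opp d ∈ P) → d ∉ g.curve → g'.label d = g.label s
  label_other : ∀ d, d ∉ P → X.opp d ∉ P → g'.label d = g.label d

/-- `g'` results from `g` by erasing the circle through `d`, which is labelled `0`. -/
structure Erase (g g' : Config X) (d : X.Dart) : Prop where
  onCircle : X.OnCircle g.curve d
  label_zero : g.label d = 0
  curve_eq : g'.curve = g.curve \ X.comp g.curve d
  label_eq : g'.label = g.label

/-- The circles of `g` through `d` and through `e` are different and cobound the annulus `A`. -/
structure Cobound (g : Config X) (d e : X.Dart) (A : Set X.Dart) : Prop where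
  onCircle_left : X.OnCircle g.curve d
  onCircle_right : X.OnCircle g.curve e
  ne : ¬ X.SameComp g.curve d e
  annulus : X.IsAnnulus A (X.comp g.curve d) (X.comp g.curve e)

/-- The circles of `g` through `d` and `e` cobound the annulus `A`, there is no further part of the
curve in `A`, and `g'` results from `g` when these two circles are replaced by the first one,
labelled with the sum of their labels. -/
structure Merge (g g' : Config X) (d e : X.Dart) (A : Set X.Dart) : Prop where
  cobound : g.Cobound d e A
  mem : e ∈ A
  empty : ∀ a ∈ A, a ∈ g.curve → a ∈ X.comp g.curve d ∪ X.comp g.curve e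
  curve_eq : g'.curve = g.curve \ X.comp g.curve e
  label_left : ∀ x ∈ X.comp g.curve d, g'.label x = g.label d + g.label e
  label_right : ∀ x ∈ X.comp g.curve e, g'.label x = 0
  label_other : ∀ x, x ∉ X.comp g.curve d → x ∉ X.comp g.curve e → g'.label x = g.label x

/-- No two different circles cobound an annulus. -/
def Reduced (g : Config X) : Prop := ∀ d e A, ¬ g.Cobound d e A

/-- The same configuration on the subdivided surface. -/
def splitEdge (g : Config X) (e : X.Dart) (he : X.opp e ≠ e) : Config (X.splitEdge e he) where
  curve := {d | Sum.elim id (fun t => if t then e else X.opp e) d ∈ g.curve}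
  label d := g.label (Sum.elim id (fun t => if t then e else X.opp e) d)

/-- The same configuration on the subdivided surface. -/
def splitBoundary (g : Config X) (e : X.Dart) : Config (X.splitBoundary e) where
  curve := {d | Sum.elim id (fun _ => e) d ∈ g.curve}
  label d := g.label (Sum.elim id (fun _ => e) d)

/-- The same configuration on the subdivided surface. -/
def splitFace (g : Config X) (a b : X.Dart) : Config (X.splitFace a b) where
  curve := Sum.inl '' g.curve
  label := Sum.elim g.label fun _ => 0

end Config

namespace ColConfig

variable {X : MarkedSurface}

/-- A checkerboard colouring of a glyph: regions abutting an arc or a circle with an odd label have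
different colours, regions abutting a circle with an even label have the same colour. -/
structure Valid (g : ColConfig X) : Prop where
  toConfig : g.toConfig.Valid
  black_next : ∀ d, X.next d ∈ g.black ↔ d ∈ g.black
  black_opp : ∀ d, X.opp d ≠ d →
    ((X.opp d ∈ g.black ↔ d ∉ g.black) ↔
      X.OnArc g.curve d ∨ (X.OnCircle g.curve d ∧ Odd (g.label d)))

/-- A push takes the polygon `P` over to the region on the other side of the curve. -/
structure Push (g g' : ColConfig X) (s : X.Dart) (k n : ℕ) (P : Set X.Dart) : Prop where
  toConfig : g.toConfig.Push g'.toConfig s k n P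
  black_mem : ∀ d ∈ P, (d ∈ g'.black ↔ X.opp s ∈ g.black)
  black_notMem : ∀ d ∉ P, (d ∈ g'.black ↔ d ∈ g.black)

structure Erase (g g' : ColConfig X) (d : X.Dart) : Prop where
  toConfig : g.toConfig.Erase g'.toConfig d
  black_eq : g'.black = g.black

/-- When the second circle is removed, the annulus `A` becomes part of the region on the other
side of that circle. -/
structure Merge (g g' : ColConfig X) (d e : X.Dart) (A : Set X.Dart) : Prop where
  toConfig : g.toConfig.Merge g'.toConfig d e A
  black_mem : ∀ x ∈ A, (x ∈ g'.black ↔ X.opp e ∈ g.black)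
  black_notMem : ∀ x ∉ A, (x ∈ g'.black ↔ x ∈ g.black)

/-- The same configuration on the subdivided surface. -/
def splitEdge (g : ColConfig X) (e : X.Dart) (he : X.opp e ≠ e) :
    ColConfig (X.splitEdge e he) where
  toConfig := g.toConfig.splitEdge e he
  black := {d | Sum.elim id (fun t => if t then e else X.opp e) d ∈ g.black}

/-- The same configuration on the subdivided surface. -/
def splitBoundary (g : ColConfig X) (e : X.Dart) : ColConfig (X.splitBoundary e) where
  toConfig := g.toConfig.splitBoundary e
  black := {d | Sum.elim id (fun _ => e) d ∈ g.black}

/-- The same configuration on the subdivided surface. -/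
def splitFace (g : ColConfig X) (a b : X.Dart) : ColConfig (X.splitFace a b) where
  toConfig := g.toConfig.splitFace a b
  black := {d | Sum.elim id (fun _ => a) d ∈ g.black}

end ColConfig

/-- The equivalence of labelled curve systems generated by isotopy relative to the boundary and by
erasure and introduction of noncontractible circles with label `0`. -/
inductive GlyphRel : (X : MarkedSurface) → Config X → Config X → Prop
  | refl {X : MarkedSurface} (g : Config X) : GlyphRel X g g
  | symm {X : MarkedSurface} {g g' : Config X} : GlyphRel X g g' → GlyphRel X g' g
  | trans {X : MarkedSurface} {g g' g'' : Config X} :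
      GlyphRel X g g' → GlyphRel X g' g'' → GlyphRel X g g''
  | push {X : MarkedSurface} {g g' : Config X} (s : X.Dart) (k n : ℕ) (P : Set X.Dart) :
      g.Valid → g'.Valid → g.Push g' s k n P → GlyphRel X g g'
  | erase {X : MarkedSurface} {g g' : Config X} (d : X.Dart) :
      g.Valid → g'.Valid → g.Erase g' d → GlyphRel X g g'
  | splitEdge {X : MarkedSurface} {g g' : Config X} (e : X.Dart) (he : X.opp e ≠ e) :
      GlyphRel (X.splitEdge e he) (g.splitEdge e he) (g'.splitEdge e he) → GlyphRel X g g'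
  | splitBoundary {X : MarkedSurface} {g g' : Config X} (e : X.Dart) (he : X.opp e = e) :
      GlyphRel (X.splitBoundary e) (g.splitBoundary e) (g'.splitBoundary e) → GlyphRel X g g'
  | splitFace {X : MarkedSurface} {g g' : Config X} (a b : X.Dart) (hab : a ≠ b)
      (h : X.next.SameCycle a b) :
      GlyphRel (X.splitFace a b) (g.splitFace a b) (g'.splitFace a b) → GlyphRel X g g'

/-- The same equivalence for coloured labelled curve systems. -/
inductive ColGlyphRel : (X : MarkedSurface) → ColConfig X → ColConfig X → Prop
  | refl {X : MarkedSurface} (g : ColConfig X) : ColGlyphRel X g g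
  | symm {X : MarkedSurface} {g g' : ColConfig X} : ColGlyphRel X g g' → ColGlyphRel X g' g
  | trans {X : MarkedSurface} {g g' g'' : ColConfig X} :
      ColGlyphRel X g g' → ColGlyphRel X g' g'' → ColGlyphRel X g g''
  | push {X : MarkedSurface} {g g' : ColConfig X} (s : X.Dart) (k n : ℕ) (P : Set X.Dart) :
      g.Valid → g'.Valid → g.Push g' s k n P → ColGlyphRel X g g'
  | erase {X : MarkedSurface} {g g' : ColConfig X} (d : X.Dart) :
      g.Valid → g'.Valid → g.Erase g' d → ColGlyphRel X g g'
  | splitEdge {X : MarkedSurface} {g g' : ColConfig X} (e : X.Dart) (he : X.opp e ≠ e) :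
      ColGlyphRel (X.splitEdge e he) (g.splitEdge e he) (g'.splitEdge e he) → ColGlyphRel X g g'
  | splitBoundary {X : MarkedSurface} {g g' : ColConfig X} (e : X.Dart) (he : X.opp e = e) :
      ColGlyphRel (X.splitBoundary e) (g.splitBoundary e) (g'.splitBoundary e) →
        ColGlyphRel X g g'
  | splitFace {X : MarkedSurface} {g g' : ColConfig X} (a b : X.Dart) (hab : a ≠ b)
      (h : X.next.SameCycle a b) :
      ColGlyphRel (X.splitFace a b) (g.splitFace a b) (g'.splitFace a b) → ColGlyphRel X g g'

/-- Glyphs for `(Σ, B)` that are represented in the given cell structure.  (Any glyph is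
represented in some subdivision; those of the states of a diagram are represented in every cell
structure that contains the diagram.) -/
def Glyph (X : MarkedSurface) : Type :=
  Quot fun g g' : {g : Config X // g.Valid} => GlyphRel X g.1 g'.1

/-- Checkerboard coloured glyphs `b^c` for `(Σ, B)`. -/
def ColoredGlyph (X : MarkedSurface) : Type :=
  Quot fun g g' : {g : ColConfig X // g.Valid} => ColGlyphRel X g.1 g'.1

/-! ### Tangle diagrams and their resolutions -/

/-- A tangle diagram on `(Σ, B)`.  The crossings sit inside quadrilateral faces: the crossing `c`
is the intersection point of the two diagonals of the embedded face with the darts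
`corner c 0, …, corner c 3` in counterclockwise order; the diagonal that joins the initial vertices
of `corner c 0` and `corner c 2` is the overcrossing strand, the other one the undercrossing strand.
Outside of these faces the diagram runs along the edges in `strand`. -/
structure TangleDiagram (X : MarkedSurface) where
  Crossing : Type
  corner : Crossing → Fin 4 → X.Dart
  strand : Set X.Dart
  next_corner : ∀ c i, X.next (corner c i) = corner c (i + 1)
  corner_inj : ∀ c i c' i', X.SameVertex (corner c i) (corner c' i') → c = c' ∧ i = i'
  corner_interior : ∀ c i, ¬ X.OnBoundary (corner c i)
  corner_notMem : ∀ c i, corner c i ∉ strand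
  corner_degree : ∀ c i, X.degree strand (corner c i) = 1
  opp_mem : ∀ d ∈ strand, X.opp d ∈ strand
  opp_ne : ∀ d ∈ strand, X.opp d ≠ d
  interior : ∀ d, ¬ X.OnBoundary d → (∀ c i, ¬ X.SameVertex d (corner c i)) →
    X.degree strand d = 0 ∨ X.degree strand d = 2
  marked : ∀ b ∈ X.marked, X.degree strand b = 1
  unmarked : ∀ b, X.opp b = b → b ∉ X.marked → X.degree strand b = 0

namespace TangleDiagram

variable {X : MarkedSurface} (T : TangleDiagram X)

/-- The diagram is connected as a subset of `Σ`. -/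
def Connected : Prop :=
  ∀ d ∈ T.strand, ∀ d' ∈ T.strand,
    EqvGen (fun a b => (a ∈ T.strand ∧ b = X.opp a) ∨ X.SameVertex a b ∨
      ∃ c i j, a = T.corner c i ∧ b = T.corner c j) d d'

/-- Over- and undercrossings alternate along the components of the tangle: an edge of the diagram
with both ends at crossings has one end on an overcrossing strand (which has the corners `0`, `2`)
and the other one on an undercrossing strand. -/
def Alternating : Prop :=
  ∀ c i c' i' d d', (c, i) ≠ (c', i') → d ∈ T.strand → d' ∈ T.strand →
    X.SameVertex d (T.corner c i) → X.SameVertex d' (T.corner c' i') →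
    X.SameComp T.strand d d' → ((i = 0 ∨ i = 2) ↔ ¬ (i' = 0 ∨ i' = 2))

/-- The dart `d` is a side of the quadrilateral around a crossing. -/
def IsCorner (d : X.Dart) : Prop := ∃ c i, d = T.corner c i

/-- `black` is a checkerboard colouring of the regions of the diagram: regions that abut along an
edge of the diagram have different colours.  Here `d ∈ black` means that the region to the left of
the dart `d` is black; for a side of a crossing quadrilateral this region contains the triangle
that the two diagonals cut out next to that side. -/
structure IsCheckerboard (black : Set X.Dart) : Prop where
  next_iff : ∀ d, ¬ T.IsCorner d → (X.next d ∈ black ↔ d ∈ black)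
  corner_iff : ∀ d, T.IsCorner d → (X.next d ∈ black ↔ d ∉ black)
  opp_iff : ∀ d, X.opp d ≠ d → ((X.opp d ∈ black ↔ d ∉ black) ↔ d ∈ T.strand)

/-- An orientation of the tangle: `fwd` is the set of the darts that point in its direction. -/
structure Orientation where
  fwd : Set X.Dart
  opp_iff : ∀ d ∈ T.strand, (X.opp d ∈ fwd ↔ d ∉ fwd)
  through : ∀ d ∈ T.strand, ∀ d' ∈ T.strand, d ≠ d' → X.SameVertex d d' → (d' ∈ fwd ↔ d ∉ fwd)
  cross : ∀ c i, ∀ d ∈ T.strand, ∀ d' ∈ T.strand, X.SameVertex d (T.corner c i) →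
    X.SameVertex d' (T.corner c (i + 2)) → (d' ∈ fwd ↔ d ∉ fwd)

variable {T} in
/-- A crossing is positive when a counterclockwise quarter turn takes the direction of the
overcrossing strand to that of the undercrossing strand. -/
def Orientation.Positive (o : T.Orientation) (c : T.Crossing) : Prop :=
  ∀ d ∈ T.strand, ∀ d' ∈ T.strand, X.SameVertex d (T.corner c 0) →
    X.SameVertex d' (T.corner c 1) → (d ∈ o.fwd ↔ d' ∈ o.fwd)

variable {T} in
/-- The number `n₊` of positive crossings. -/
def Orientation.nPlus (o : T.Orientation) : ℕ := {c | o.Positive c}.ncard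

/-- The resolution `r_S`.  The `0`-resolution of a crossing replaces its two strands by the sides
`1` and `3` of the quadrilateral (so that it joins the two regions swept out when the overcrossing
strand is turned counterclockwise), the `1`-resolution replaces them by the sides `0` and `2`. -/
def resolution (S : Finset T.Crossing) : Set X.Dart :=
  T.strand ∪ {d | ∃ c i, (d = T.corner c i ∨ X.opp d = T.corner c i) ∧
    (c ∈ S ↔ (i = 0 ∨ i = 2))}

/-- The colouring of the regions of `r_S` induced by that of the diagram: away from the crossings
nothing changes, and the quadrilateral at a crossing becomes part of the regions that the resolution
joins, those across the two sides that are not used. -/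
def resolutionBlack (black : Set X.Dart) (S : Finset T.Crossing) : Set X.Dart :=
  {d | (T.IsCorner d ∧ d ∈ T.resolution S ∧ X.next d ∈ black) ∨
    (¬ (T.IsCorner d ∧ d ∈ T.resolution S) ∧ d ∈ black)}

/-- A resolution `r_S` with a sign on each of its noncontractible circles (`sign` is constant along
these and `0` elsewhere). -/
@[ext] structure State where
  ones : Finset T.Crossing
  sign : X.Dart → SignType
  sign_eq : ∀ d d', X.SameComp (T.resolution ones) d d' → sign d = sign d'
  sign_ne_zero : ∀ d, sign d ≠ 0 ↔
    X.OnCircle (T.resolution ones) d ∧ ¬ X.Contractible (T.resolution ones) d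

theorem finite_crossing : Finite T.Crossing :=
  Finite.of_injective (fun c => T.corner c 0) fun c c' h =>
    (T.corner_inj c 0 c' 0 (by
      have h' : T.corner c 0 = T.corner c' 0 := h
      rw [h']
      exact EqvGen.refl _)).1

instance : Finite T.State := by
  have := T.finite_crossing
  exact Finite.of_injective (fun r : T.State => (r.ones, r.sign)) fun r r' h => by
    simp only [Prod.mk.injEq] at h
    exact State.ext h.1 h.2

namespace State

variable {T}
variable (r : T.State)

/-- The resolution has no contractible circle. -/
def Essential : Prop := ∀ d, ¬ X.Contractible (T.resolution r.ones) d

/-- The arcs and the noncontractible circles, labelled by their signs. -/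
def config : Config X where
  curve := {d | d ∈ T.resolution r.ones ∧ ¬ X.Contractible (T.resolution r.ones) d}
  label d := (r.sign d : ℤ)

/-- The same with the colouring induced from the diagram (used only without contractible
circles). -/
def colConfig (black : Set X.Dart) : ColConfig X where
  toConfig := r.config
  black := T.resolutionBlack black r.ones

/-- The glyph of `r` is `b`: after the contractible circles have been erased, each collection of
circles that pairwise cobound annuli is replaced by one circle labelled with the sum of the signs,
and the result represents `b`. -/
def HasGlyph (b : Glyph X) : Prop :=
  ∃ g : Config X, ReflTransGen (fun h h' => ∃ d e A, h.Merge h' d e A) r.config g ∧ g.Reduced ∧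
    ∃ hg : g.Valid, Quot.mk _ ⟨g, hg⟩ = b

/-- The glyph of `r` is `b` and `r` colours it as `b^c`. -/
def HasColoredGlyph (black : Set X.Dart) (bc : ColoredGlyph X) : Prop :=
  ∃ g : ColConfig X, ReflTransGen (fun h h' => ∃ d e A, h.Merge h' d e A) (r.colConfig black) g ∧
    g.toConfig.Reduced ∧ ∃ hg : g.Valid, Quot.mk _ ⟨g, hg⟩ = bc

end State

/-! ### The chain complex -/

/-- The edges of the diagram: the components of the diagram without its crossings. -/
def Edge : Type := Quot fun d d' : T.strand => X.SameComp T.strand d d'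

/-- The field `𝔽_T` of rational functions over `ℤ/2ℤ` in one variable for each edge. -/
def CoeffField : Type := FractionRing (MvPolynomial T.Edge (ZMod 2))

instance : Field T.CoeffField :=
  inferInstanceAs (Field (FractionRing (MvPolynomial T.Edge (ZMod 2))))

/-- The formal variable `x_f` of an edge. -/
def formalVar (f : T.Edge) : T.CoeffField :=
  algebraMap (MvPolynomial T.Edge (ZMod 2)) (FractionRing (MvPolynomial T.Edge (ZMod 2)))
    (MvPolynomial.X f)

/-- The weight `[K]`: the sum of the variables of the edges that lie on `K`. -/
def weight (K : Set X.Dart) : T.CoeffField :=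
  ∑ᶠ f ∈ {f : T.Edge | ∃ d : T.strand, (d : X.Dart) ∈ K ∧ f = Quot.mk _ d},
    T.formalVar f

/-- The contractible circles of the resolution `r_S`. -/
def contractibleCircles (S : Finset T.Crossing) : Set (Set X.Dart) :=
  {K | ∃ d, X.Contractible (T.resolution S) d ∧ K = X.comp (T.resolution S) d}

/-- The state `t` arises from `r` when the crossing `c` is changed from its `0`-resolution to its
`1`-resolution, and the circles that do not pass through `c` keep their signs. -/
def Flip (c : T.Crossing) (r t : T.State) : Prop :=
  c ∉ r.ones ∧ (t.ones : Set T.Crossing) = insert c (r.ones : Set T.Crossing) ∧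
    ∀ d, (∀ d', X.SameComp (T.resolution r.ones) d d' → ∀ i, ¬ X.SameVertex d' (T.corner c i)) →
      t.sign d = r.sign d

/-- The coefficient `⟨r, r'⟩`.  If `r'` arises from `r` by changing the resolutions at two
crossings, it is the sum of `1 / [C]` over the intermediate states (at most one for each
of the two orders in which the crossings can be changed) with the same glyph and over
their contractible circles `C`.  Otherwise it is `0`. -/
def pairing (r r' : T.State) : T.CoeffField :=
  ∑ᶠ t ∈ {t : T.State | (∃ c c', T.Flip c r t ∧ T.Flip c' t r') ∧
      ∃ b : Glyph X, r.HasGlyph b ∧ t.HasGlyph b ∧ r'.HasGlyph b},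
    ∑ᶠ K ∈ T.contractibleCircles t.ones, (T.weight K)⁻¹

/-- The set `𝒪_{nc,i}(T, b^c)` of generators. -/
def Gen (black : Set X.Dart) (bc : ColoredGlyph X) (i : ℤ) : Type :=
  {r : T.State // r.Essential ∧ (r.ones.card : ℤ) = i ∧ r.HasColoredGlyph black bc}

instance (black : Set X.Dart) (bc : ColoredGlyph X) (i : ℤ) : Finite (T.Gen black bc i) :=
  inferInstanceAs (Finite {_r : T.State // _})

instance (black : Set X.Dart) (bc : ColoredGlyph X) (i : ℤ) : Fintype (T.Gen black bc i) :=
  Fintype.ofFinite _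

/-- The chain group `CT_i(T, b^c)`. -/
def CT (black : Set X.Dart) (bc : ColoredGlyph X) (i : ℤ) : Type :=
  T.Gen black bc i →₀ T.CoeffField

instance (black : Set X.Dart) (bc : ColoredGlyph X) (i : ℤ) : AddCommGroup (T.CT black bc i) :=
  inferInstanceAs (AddCommGroup (T.Gen black bc i →₀ T.CoeffField))

instance (black : Set X.Dart) (bc : ColoredGlyph X) (i : ℤ) :
    Module T.CoeffField (T.CT black bc i) :=
  inferInstanceAs (Module T.CoeffField (T.Gen black bc i →₀ T.CoeffField))

/-- The basis element of `CT_i(T, b^c)` given by a generator. -/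
def basisElt {black : Set X.Dart} {bc : ColoredGlyph X} {i : ℤ} (r : T.Gen black bc i) :
    T.CT black bc i :=
  (Finsupp.single r 1 : T.Gen black bc i →₀ T.CoeffField)

/-- The component `CT_i(T, b^c) → CT_j(T, b^c)` of the boundary map `∂_n`; since `⟨r, r'⟩ = 0`
unless `|r'| = |r| + 2`, only the one with `j = i + 2` can be nonzero. -/
def boundary (black : Set X.Dart) (bc : ColoredGlyph X) (i j : ℤ) :
    T.CT black bc i →ₗ[T.CoeffField] T.CT black bc j :=
  Finsupp.linearCombination T.CoeffField fun r =>
    ∑ r' : T.Gen black bc j, T.pairing r.1 r'.1 • T.basisElt r'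

/-- The homology of `CT_*(T, b^c)` at `CT_i(T, b^c)`. -/
abbrev HT (black : Set X.Dart) (bc : ColoredGlyph X) (i : ℤ) : Type :=
  LinearMap.ker (T.boundary black bc i (i + 2)) ⧸
    (LinearMap.range (T.boundary black bc (i - 2) i)).submoduleOf
      (LinearMap.ker (T.boundary black bc i (i + 2)))

variable {T} in
/-- The chain group in degree `j` of the shifted complex `CT_*(T, b^c)[-n₊]`. -/
abbrev Orientation.CT (o : T.Orientation) (black : Set X.Dart) (bc : ColoredGlyph X) (j : ℤ) :
    Type :=
  T.CT black bc (j + o.nPlus)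

variable {T} in
/-- The homology group in degree `j` of the shifted complex `CT_*(T, b^c)[-n₊]`. -/
abbrev Orientation.HT (o : T.Orientation) (black : Set X.Dart) (bc : ColoredGlyph X) (j : ℤ) :
    Type :=
  T.HT black bc (j + o.nPlus)

end TangleDiagram

end

/-!
The Euler characteristic of the black part of a checkerboard coloured surface determines the
homological grading.

On the one hand, it is an invariant of coloured glyphs (`ColoredGlyph.euler`). Pushing an arc of
the curve across a polygon recolours this polygon, which is attached to the rest of the black part
along a path (`ColConfig.euler_of_push`); erasing a circle with label `0` recolours nothing;
subdivisions of the cell structure change the numbers of vertices, edges and faces compatibly. When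
parallel circles are merged, an annulus is recoloured, which is attached to the rest of the black
part along some of its boundary circles, and annuli and circles have Euler characteristic zero
(`ColConfig.euler_of_merge`). So the glyph of a state without contractible circles has the same
Euler characteristic as the resolution itself.

On the other hand, changing a crossing from its `0`- to its `1`-resolution removes its
quadrilateral from the black part, or adds it, and thereby changes the Euler characteristic by `1`
or `-1`; the sign is given by the colour of the regions that the `0`-resolution joins
(`TangleDiagram.euler_resolutionBlack_insert`). Along an edge of an alternating diagram this colour
is the same at both ends, hence it is the same at all crossings of a connected diagram
(`TangleDiagram.corner_mem_black_iff_corner`). So the Euler characteristic of a resolution is an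
affine function of the number of `1`-resolved crossings with slope `1` or `-1`, and states with the
same coloured glyph lie in the same degree. The boundary map raises the degree by two, and therefore
vanishes.
-/

open Relation
open MarkedSurface

/-! ### Counting -/

/-- Two families over the same index set with the same coincidences have equally many members. -/
theorem ncard_image_eq_of_eq_iff {α β γ : Type*} {s : Set α} {f : α → β} {g : α → γ}
    (h : ∀ a ∈ s, ∀ b ∈ s, f a = f b ↔ g a = g b) : (f '' s).ncard = (g '' s).ncard := by
  classical
  refine Set.ncard_congr (fun y hy => g hy.choose) ?_ ?_ ?_
  · intro y hy
    exact ⟨_, hy.choose_spec.1, rfl⟩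
  · intro y z hy hz hyz
    rw [← hy.choose_spec.2, ← hz.choose_spec.2]
    exact (h _ hy.choose_spec.1 _ hz.choose_spec.1).2 hyz
  · rintro _ ⟨a, ha, rfl⟩
    have hy : f a ∈ f '' s := ⟨a, ha, rfl⟩
    exact ⟨f a, hy, (h _ hy.choose_spec.1 _ ha).1 hy.choose_spec.2⟩

theorem ncard_image_comp {α α' β γ : Type*} {s : Set α'} {p : α' → α} {f : α' → β} {g : α → γ}
    (h : ∀ a ∈ s, ∀ b ∈ s, f a = f b ↔ g (p a) = g (p b)) :
    (f '' s).ncard = (g '' (p '' s)).ncard := by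
  rw [Set.image_image]
  exact ncard_image_eq_of_eq_iff h

/-- A map all of whose fibres over its image have two points halves the cardinality. -/
theorem ncard_eq_two_mul_ncard_image {α β : Type*} [Finite α] {s : Set α} {f : α → β}
    (h : ∀ a ∈ s, {b | b ∈ s ∧ f b = f a}.ncard = 2) : s.ncard = 2 * (f '' s).ncard := by
  classical
  have := Fintype.ofFinite α
  rw [Set.ncard_eq_toFinset_card', Set.ncard_eq_toFinset_card', Set.toFinset_image,
    Finset.card_eq_sum_card_image f, Finset.sum_const_nat (m := 2), mul_comm]
  intro y hy
  obtain ⟨a, ha, rfl⟩ := Finset.mem_image.1 hy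
  rw [← h a (by simpa using ha), Set.ncard_eq_toFinset_card']
  congr 1
  ext b
  simp

namespace MarkedSurface

variable {X : MarkedSurface}

/-! ### Vertices, curves and unions of faces -/

theorem SameVertex.refl (d : X.Dart) : X.SameVertex d d := EqvGen.refl d

theorem SameVertex.symm {d d' : X.Dart} (h : X.SameVertex d d') : X.SameVertex d' d :=
  EqvGen.symm _ _ h

theorem SameVertex.trans {a b c : X.Dart} (h : X.SameVertex a b) (h' : X.SameVertex b c) :
    X.SameVertex a c :=
  EqvGen.trans _ _ _ h h'

theorem mk_eq_iff_sameVertex {d d' : X.Dart} :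
    Quot.mk X.SameVertex d = Quot.mk X.SameVertex d' ↔ X.SameVertex d d' := by
  rw [Quot.eq, SameVertex, (EqvGen.is_equivalence _).eqvGen_iff]

theorem mk_eq_iff_sameCycle {α : Type*} {f : Equiv.Perm α} {d d' : α} :
    Quot.mk f.SameCycle d = Quot.mk f.SameCycle d' ↔ f.SameCycle d d' := by
  rw [Quot.eq]
  exact Equivalence.eqvGen_iff
    ⟨Equiv.Perm.SameCycle.refl f, Equiv.Perm.SameCycle.symm, Equiv.Perm.SameCycle.trans⟩

theorem sameVertex_next_opp {d : X.Dart} (h : X.opp d ≠ d) :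
    X.SameVertex d (X.next (X.opp d)) :=
  EqvGen.rel _ _ ⟨h, rfl⟩

theorem sameVertex_opp_next {d : X.Dart} (h : X.opp d ≠ d) :
    X.SameVertex (X.opp d) (X.next d) := by
  have h' : X.opp (X.opp d) ≠ X.opp d := fun h' => h (by rw [X.opp_opp] at h'; exact h'.symm)
  simpa [X.opp_opp] using sameVertex_next_opp h'

theorem OnBoundary.of_sameVertex {d d' : X.Dart} (h : X.OnBoundary d)
    (hd : X.SameVertex d' d) : X.OnBoundary d' :=
  let ⟨b, hb, hdb⟩ := h
  ⟨b, hb, hd.trans hdb⟩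

theorem degree_congr (C : Set X.Dart) {d d' : X.Dart} (h : X.SameVertex d d') :
    X.degree C d = X.degree C d' := by
  unfold degree
  congr 1
  ext x
  exact and_congr_left fun _ => ⟨fun hx => h.symm.trans hx, fun hx => h.trans hx⟩

theorem SameComp.symm {C : Set X.Dart} {d d' : X.Dart} (h : X.SameComp C d d') :
    X.SameComp C d' d :=
  EqvGen.symm _ _ h

theorem SameComp.trans {C : Set X.Dart} {a b c : X.Dart} (h : X.SameComp C a b)
    (h' : X.SameComp C b c) : X.SameComp C a c :=
  EqvGen.trans _ _ _ h h'

theorem SameComp.mem_iff {C : Set X.Dart} {d d' : X.Dart} (h : X.SameComp C d d') :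
    d ∈ C ↔ d' ∈ C := by
  induction h with
  | rel x y h => exact iff_of_true h.1 h.2.1
  | refl => rfl
  | symm _ _ _ ih => exact ih.symm
  | trans _ _ _ _ _ ih ih' => exact ih.trans ih'

theorem SameComp.mono {C C' : Set X.Dart} (hC : C ⊆ C') {d d' : X.Dart}
    (h : X.SameComp C d d') : X.SameComp C' d d' :=
  EqvGen.mono (fun _ _ h => ⟨hC h.1, hC h.2.1, h.2.2⟩) _ _ h

theorem SameComp.of_sameVertex {C : Set X.Dart} {d d' : X.Dart} (h : X.SameVertex d d')
    (hd : d ∈ C) (hd' : d' ∈ C) : X.SameComp C d d' :=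
  EqvGen.rel _ _ ⟨hd, hd', Or.inr h⟩

theorem SameComp.of_opp {C : Set X.Dart} {d : X.Dart} (hd : d ∈ C) (hd' : X.opp d ∈ C) :
    X.SameComp C d (X.opp d) :=
  EqvGen.rel _ _ ⟨hd, hd', Or.inl rfl⟩

theorem OnArc.congr {C : Set X.Dart} {d d' : X.Dart} (h : X.SameComp C d d') :
    X.OnArc C d ↔ X.OnArc C d' :=
  and_congr h.mem_iff <| exists_congr fun _ => and_congr_right fun _ => exists_congr fun _ =>
    and_congr_right fun _ => and_congr_left fun _ => ⟨h.symm.trans, h.trans⟩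

theorem OnCircle.congr {C : Set X.Dart} {d d' : X.Dart} (h : X.SameComp C d d') :
    X.OnCircle C d ↔ X.OnCircle C d' :=
  and_congr h.mem_iff (not_congr (OnArc.congr h))

namespace IsCurve

variable {C : Set X.Dart}

theorem degree_le_one (hC : X.IsCurve C) {d : X.Dart} (hd : X.OnBoundary d) :
    X.degree C d ≤ 1 := by
  obtain ⟨b, hb, hdb⟩ := hd
  rw [degree_congr C hdb]
  by_cases hm : b ∈ X.marked
  · exact (hC.marked b hm).le
  · simp [hC.unmarked b hb hm]

theorem degree_le_two (hC : X.IsCurve C) (d : X.Dart) : X.degree C d ≤ 2 := by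
  by_cases hd : X.OnBoundary d
  · exact (hC.degree_le_one hd).trans one_le_two
  · rcases hC.interior d hd with h | h <;> simp [h]

/-- At most two darts of a curve start at any vertex. -/
theorem eq_or_eq_of_sameVertex (hC : X.IsCurve C) {a b c : X.Dart} (ha : a ∈ C) (hb : b ∈ C)
    (hc : c ∈ C) (hab : a ≠ b) (h : X.SameVertex a b) (h' : X.SameVertex a c) :
    c = a ∨ c = b := by
  by_contra! hne
  have hsub : ({a, b, c} : Set X.Dart) ⊆ {d' | X.SameVertex a d' ∧ d' ∈ C} := by
    rintro x (rfl | rfl | rfl)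
    exacts [⟨.refl _, ha⟩, ⟨h, hb⟩, ⟨h', hc⟩]
  have := Set.ncard_le_ncard hsub
  rw [Set.ncard_eq_three.2 ⟨a, b, c, hab, hne.1.symm, hne.2.symm, rfl⟩] at this
  have h2 := hC.degree_le_two a
  unfold degree at h2
  omega

theorem not_onBoundary_of_onCircle (hC : X.IsCurve C) {d : X.Dart} (hd : X.OnCircle C d) :
    ¬ X.OnBoundary d := by
  rintro ⟨b, hb, hdb⟩
  by_cases hm : b ∈ X.marked
  · exact hd.2 ⟨hd.1, b, hm, d, hd.1, EqvGen.refl _, hdb⟩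
  · have h0 := hC.unmarked b hb hm
    rw [← degree_congr C hdb, degree, Set.ncard_eq_zero] at h0
    exact (h0.le ⟨.refl d, hd.1⟩ : d ∈ (∅ : Set X.Dart))

theorem degree_of_onCircle (hC : X.IsCurve C) {d : X.Dart} (hd : X.OnCircle C d) :
    X.degree C d = 2 := by
  refine (hC.interior d (hC.not_onBoundary_of_onCircle hd)).resolve_left fun h0 => ?_
  rw [degree, Set.ncard_eq_zero] at h0
  exact (h0.le ⟨.refl d, hd.1⟩ : d ∈ (∅ : Set X.Dart))

end IsCurve

/-- The vertices of the union of closed faces `F`. -/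
def verts (F : Set X.Dart) : Set (Quot X.SameVertex) := Quot.mk X.SameVertex '' F

/-- The edges of the union of closed faces `F`. -/
def edges (F : Set X.Dart) : Set (Sym2 X.Dart) := (fun d => s(d, X.opp d)) '' F

/-- The faces that form `F`. -/
def faces (F : Set X.Dart) : Set (Quot X.next.SameCycle) := Quot.mk X.next.SameCycle '' F

theorem euler_eq (F : Set X.Dart) :
    X.euler F = ((verts F).ncard : ℤ) - (edges F).ncard + (faces F).ncard := rfl

theorem mk_mem_verts {F : Set X.Dart} {d : X.Dart} :
    Quot.mk X.SameVertex d ∈ verts F ↔ ∃ f ∈ F, X.SameVertex f d := by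
  simp [verts, mk_eq_iff_sameVertex]

theorem edge_eq_iff {d d' : X.Dart} :
    s(d, X.opp d) = s(d', X.opp d') ↔ d = d' ∨ d = X.opp d' := by
  rw [Sym2.eq_iff]
  constructor
  · rintro (h | h)
    exacts [Or.inl h.1, Or.inr h.1]
  · rintro (rfl | rfl)
    · simp
    · simp [X.opp_opp]

theorem mem_edges {F : Set X.Dart} {d : X.Dart} :
    s(d, X.opp d) ∈ edges F ↔ d ∈ F ∨ X.opp d ∈ F := by
  simp only [edges, Set.mem_image, edge_eq_iff]
  constructor
  · rintro ⟨f, hf, rfl | rfl⟩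
    exacts [Or.inl hf, Or.inr hf]
  · rintro (h | h)
    exacts [⟨d, h, Or.inl rfl⟩, ⟨_, h, Or.inr rfl⟩]

/-- A set of darts that is a union of faces. -/
def FaceClosed (F : Set X.Dart) : Prop := ∀ d, X.next d ∈ F ↔ d ∈ F

theorem faceClosed_of_mapsTo {F : Set X.Dart} (h : ∀ d ∈ F, X.next d ∈ F) : FaceClosed F := by
  intro d
  refine ⟨fun hd => ?_, h d⟩
  have hc : X.next.SameCycle (X.next d) d := ⟨-1, by simp⟩
  obtain ⟨n, hn⟩ := hc.exists_nat_pow_eq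
  rw [← hn]
  clear hn
  induction n with
  | zero => simpa
  | succ n ih => rw [pow_succ', Equiv.Perm.mul_apply]; exact h _ ih

namespace FaceClosed

variable {F G : Set X.Dart}

theorem mem_iff_of_sameCycle (hF : FaceClosed F) {d d' : X.Dart} (h : X.next.SameCycle d d') :
    d ∈ F ↔ d' ∈ F := by
  obtain ⟨n, rfl⟩ := h.exists_nat_pow_eq
  clear h
  induction n with
  | zero => simp
  | succ n ih => rw [pow_succ', Equiv.Perm.mul_apply, hF]; exact ih

theorem iterate_mem_iff (hF : FaceClosed F) (n : ℕ) (d : X.Dart) :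
    X.next^[n] d ∈ F ↔ d ∈ F := by
  induction n with
  | zero => rfl
  | succ n ih => rw [Function.iterate_succ_apply', hF, ih]

theorem diff (hF : FaceClosed F) (hG : FaceClosed G) : FaceClosed (F \ G) := fun d => by
  simp only [Set.mem_sdiff, hF d, hG d]

/-- A union of faces that has no frontier at a vertex contains all corners at it or none. -/
theorem mem_iff_of_sameVertex (hF : FaceClosed F) {d d' : X.Dart} (h : X.SameVertex d d')
    (hd : ∀ x, X.SameVertex d x → (X.opp x ∈ F ↔ x ∈ F)) : d ∈ F ↔ d' ∈ F := by
  have key : ∀ a b, X.SameVertex a b → X.SameVertex d a → (a ∈ F ↔ b ∈ F) := by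
    intro a b hab
    induction hab with
    | rel x y h => intro hx; rw [h.2, hF, hd x hx]
    | refl => exact fun _ => Iff.rfl
    | symm x y h ih => exact fun hy => (ih (hy.trans (SameVertex.symm h))).symm
    | trans x y z h _ ih ih' => exact fun hx => (ih hx).trans (ih' (hx.trans h))
  exact key _ _ h (.refl d)

theorem exists_frontier_of_sameVertex (hF : FaceClosed F) {d d' : X.Dart} (hd : d ∈ F)
    (hd' : d' ∉ F) (h : X.SameVertex d d') :
    ∃ x, X.SameVertex d x ∧ ¬ (X.opp x ∈ F ↔ x ∈ F) := by
  by_contra! hx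
  exact hd' ((hF.mem_iff_of_sameVertex h hx).1 hd)

/-- Both ends of an edge of a face are vertices of that face. -/
theorem mk_mem_verts_of_opp_mem (hF : FaceClosed F) {d : X.Dart} (hd : X.opp d ≠ d)
    (h : X.opp d ∈ F) : Quot.mk X.SameVertex d ∈ verts F :=
  mk_mem_verts.2 ⟨_, (hF _).2 h, (sameVertex_next_opp hd).symm⟩

end FaceClosed

/-- Inclusion-exclusion for the Euler characteristic of two unions of faces without a common
face. -/
theorem euler_union {F G : Set X.Dart} (hF : FaceClosed F) (hFG : Disjoint F G) :
    X.euler (F ∪ G) = X.euler F + X.euler G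
      - (((verts F ∩ verts G).ncard : ℤ) - (edges F ∩ edges G).ncard) := by
  have hv := Set.ncard_union_add_ncard_inter (verts F) (verts G)
  have he := Set.ncard_union_add_ncard_inter (edges F) (edges G)
  have hf := Set.ncard_union_add_ncard_inter (faces F) (faces G)
  have h0 : faces F ∩ faces G = ∅ := by
    rw [← Set.disjoint_iff_inter_eq_empty, Set.disjoint_left]
    rintro _ ⟨a, ha, rfl⟩ ⟨b, hb, hab⟩
    exact Set.disjoint_left.1 hFG ((hF.mem_iff_of_sameCycle (mk_eq_iff_sameCycle.1 hab)).2 ha) hb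
  rw [h0, Set.ncard_empty] at hf
  simp only [euler_eq]
  rw [show verts (F ∪ G) = verts F ∪ verts G from Set.image_union ..,
    show edges (F ∪ G) = edges F ∪ edges G from Set.image_union ..,
    show faces (F ∪ G) = faces F ∪ faces G from Set.image_union ..]
  push_cast [← Nat.cast_inj (R := ℤ)] at hv he hf
  linarith

/-- A closed face with `n` sides whose vertices are pairwise different and whose sides are not glued
to each other. -/
structure IsPolygon (s : X.Dart) (n : ℕ) (P : Set X.Dart) : Prop where
  face : P = {d | ∃ i < n, d = X.next^[i] s}
  pos : 0 < n
  closed : X.next^[n] s = s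
  embedded : ∀ i < n, ∀ j < n, X.SameVertex (X.next^[i] s) (X.next^[j] s) → i = j
  opp_notMem : ∀ d ∈ P, X.opp d ∉ P

namespace IsPolygon

variable {s : X.Dart} {n : ℕ} {P : Set X.Dart}

theorem iterate_mem (hP : IsPolygon s n P) {i : ℕ} (hi : i < n) : X.next^[i] s ∈ P := by
  rw [hP.face]; exact ⟨i, hi, rfl⟩

theorem opp_ne (hP : IsPolygon s n P) {d : X.Dart} (hd : d ∈ P) : X.opp d ≠ d := fun h =>
  hP.opp_notMem d hd (h.symm ▸ hd)

theorem faceClosed (hP : IsPolygon s n P) : FaceClosed P := by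
  refine faceClosed_of_mapsTo fun d hd => ?_
  rw [hP.face] at hd
  obtain ⟨i, hi, rfl⟩ := hd
  rw [← Function.iterate_succ_apply' X.next i s]
  rcases Nat.lt_or_eq_of_le (Nat.succ_le_of_lt hi) with h | h
  · exact hP.iterate_mem h
  · rw [h, hP.closed]; exact hP.iterate_mem hP.pos

/-- Attaching a polygon along some of its vertices and sides. -/
theorem euler_union (hP : IsPolygon s n P) {F : Set X.Dart} (hF : FaceClosed F)
    (hFP : Disjoint F P) (I J : Finset ℕ)
    (hI : ∀ i, i ∈ I ↔ i < n ∧ Quot.mk X.SameVertex (X.next^[i] s) ∈ verts F)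
    (hJ : ∀ i, i ∈ J ↔ i < n ∧ X.opp (X.next^[i] s) ∈ F) :
    X.euler (F ∪ P) = X.euler F + 1 - ((I.card : ℤ) - J.card) := by
  have hPimg : P = (fun i => X.next^[i] s) '' (Finset.range n : Set ℕ) := by
    rw [hP.face]
    ext d
    simp [eq_comm]
  have hvinj : Set.InjOn (fun i => Quot.mk X.SameVertex (X.next^[i] s))
      (Finset.range n : Set ℕ) := by
    intro i hi j hj h
    exact hP.embedded i (by simpa using hi) j (by simpa using hj) (mk_eq_iff_sameVertex.1 h)
  have heinj : Set.InjOn (fun i => s(X.next^[i] s, X.opp (X.next^[i] s)))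
      (Finset.range n : Set ℕ) := by
    intro i hi j hj h
    rcases edge_eq_iff.1 h with h | h
    · exact hP.embedded i (by simpa using hi) j (by simpa using hj) (h ▸ .refl _)
    · exact absurd (h ▸ hP.iterate_mem (by simpa using hi))
        (hP.opp_notMem _ (hP.iterate_mem (by simpa using hj)))
  have hv : verts P =
      (fun i => Quot.mk X.SameVertex (X.next^[i] s)) '' (Finset.range n : Set ℕ) := by
    rw [verts, hPimg, Set.image_image]
  have he : edges P =
      (fun i => s(X.next^[i] s, X.opp (X.next^[i] s))) '' (Finset.range n : Set ℕ) := by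
    rw [edges, hPimg, Set.image_image]
  have hv' : verts F ∩ verts P = (fun i => Quot.mk X.SameVertex (X.next^[i] s)) '' (I : Set ℕ) := by
    rw [hv]
    ext v
    constructor
    · rintro ⟨hvF, i, hi, rfl⟩
      exact ⟨i, (hI i).2 ⟨by simpa using hi, hvF⟩, rfl⟩
    · rintro ⟨i, hi, rfl⟩
      have := (hI i).1 hi
      exact ⟨this.2, i, by simpa using this.1, rfl⟩
  have he' : edges F ∩ edges P =
      (fun i => s(X.next^[i] s, X.opp (X.next^[i] s))) '' (J : Set ℕ) := by
    rw [he]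
    ext v
    constructor
    · rintro ⟨hvF, i, hi, rfl⟩
      have hi' : i < n := by simpa using hi
      refine ⟨i, (hJ i).2 ⟨hi', ?_⟩, rfl⟩
      exact (mem_edges.1 hvF).resolve_left fun h =>
        Set.disjoint_left.1 hFP h (hP.iterate_mem hi')
    · rintro ⟨i, hi, rfl⟩
      have := (hJ i).1 hi
      exact ⟨mem_edges.2 (Or.inr this.2), i, by simpa using this.1, rfl⟩
  have hIn : (I : Set ℕ) ⊆ (Finset.range n : Set ℕ) := fun i hi => by
    simpa using ((hI i).1 hi).1
  have hJn : (J : Set ℕ) ⊆ (Finset.range n : Set ℕ) := fun i hi => by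
    simpa using ((hJ i).1 hi).1
  have hf : faces P = {Quot.mk _ s} := by
    apply Set.Subset.antisymm
    · rintro _ ⟨d, hd, rfl⟩
      rw [hP.face] at hd
      obtain ⟨i, -, rfl⟩ := hd
      refine mk_eq_iff_sameCycle.2 (Equiv.Perm.SameCycle.symm ⟨i, ?_⟩)
      rw [zpow_natCast, ← Equiv.Perm.iterate_eq_pow]
    · rintro _ rfl
      exact ⟨s, hP.iterate_mem hP.pos, rfl⟩
  rw [MarkedSurface.euler_union hF hFP, hv', he', (hvinj.mono hIn).ncard_image,
    (heinj.mono hJn).ncard_image, euler_eq P, hv, he, hvinj.ncard_image, heinj.ncard_image, hf]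
  simp only [Set.ncard_coe_finset, Set.ncard_singleton]
  push_cast
  ring

end IsPolygon

/-- A union of circles has as many vertices as edges. -/
theorem IsCurve.ncard_verts_eq_ncard_edges {C M : Set X.Dart} (hC : X.IsCurve C)
    (hM : ∀ d ∈ M, X.OnCircle C d) (hcomp : ∀ d ∈ M, ∀ d', X.SameComp C d d' → d' ∈ M) :
    (verts M).ncard = (edges M).ncard := by
  have hv := ncard_eq_two_mul_ncard_image (s := M) (f := Quot.mk X.SameVertex) fun a ha => by
    rw [← hC.degree_of_onCircle (hM a ha), degree]
    congr 1
    ext b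
    rw [Set.mem_ofPred_eq, Set.mem_ofPred_eq, mk_eq_iff_sameVertex]
    exact ⟨fun h => ⟨h.2.symm, (hM b h.1).1⟩, fun h =>
      ⟨hcomp a ha b (.of_sameVertex h.1 (hM a ha).1 h.2), h.1.symm⟩⟩
  have he := ncard_eq_two_mul_ncard_image (s := M) (f := fun d => s(d, X.opp d)) fun a ha => by
    rw [Set.ncard_eq_two]
    refine ⟨a, X.opp a, (hC.opp_ne a (hM a ha).1).symm, ?_⟩
    ext b
    simp only [Set.mem_ofPred_eq, edge_eq_iff, Set.mem_insert_iff, Set.mem_singleton_iff]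
    refine ⟨fun h => h.2, fun h => ⟨?_, h⟩⟩
    rcases h with rfl | rfl
    · exact ha
    · exact hcomp a ha _ (.of_opp (hM a ha).1 (hC.opp_mem a (hM a ha).1))
  simp only [verts, edges]
  omega

end MarkedSurface

namespace MarkedSurface

variable {X : MarkedSurface}

/-! ### Subdivision -/

/-- The cell structure `Y` arises from `X` by subdividing the edge `{e, opp e}`: a dart `d` survives
as `ι d`, the dart `ι e` is followed by `u` and `ι (opp e)` by `v`; `p` sends a dart of `Y` to the
dart of `X` that contains it. -/
structure IsEdgeSplit (e : X.Dart) {Y : MarkedSurface} (ι : X.Dart → Y.Dart) (u v : Y.Dart)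
    (p : Y.Dart → X.Dart) : Prop where
  opp_ne : X.opp e ≠ e
  cases : ∀ y, (∃ d, y = ι d) ∨ y = u ∨ y = v
  p_inl : ∀ d, p (ι d) = d
  p_u : p u = e
  p_v : p v = X.opp e
  inl_ne_u : ∀ d, ι d ≠ u
  inl_ne_v : ∀ d, ι d ≠ v
  opp_left : Y.opp (ι e) = v
  opp_right : Y.opp (ι (X.opp e)) = u
  opp_u : Y.opp u = ι (X.opp e)
  opp_v : Y.opp v = ι e
  opp_of_ne : ∀ d, d ≠ e → d ≠ X.opp e → Y.opp (ι d) = ι (X.opp d)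
  next_left : Y.next (ι e) = u
  next_right : Y.next (ι (X.opp e)) = v
  next_u : Y.next u = ι (X.next e)
  next_v : Y.next v = ι (X.next (X.opp e))
  next_of_ne : ∀ d, d ≠ e → d ≠ X.opp e → Y.next (ι d) = ι (X.next d)

namespace IsEdgeSplit

variable {e : X.Dart} {Y : MarkedSurface} {ι : X.Dart → Y.Dart} {u v : Y.Dart}
  {p : Y.Dart → X.Dart} (h : IsEdgeSplit e ι u v p)
include h

theorem injective : Function.Injective ι := fun a b hab => by
  rw [← h.p_inl a, hab, h.p_inl]

theorem faceClosed_iff {F : Set X.Dart} : FaceClosed (p ⁻¹' F) ↔ FaceClosed F := by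
  constructor
  · intro hF d
    by_cases h1 : d = e
    · simpa [h.next_u, h.p_inl, h.p_u, h1] using hF u
    by_cases h2 : d = X.opp e
    · simpa [h.next_v, h.p_inl, h.p_v, h2] using hF v
    simpa [h.next_of_ne d h1 h2, h.p_inl] using hF (ι d)
  · intro hF y
    rcases h.cases y with ⟨d, rfl⟩ | rfl | rfl
    · by_cases h1 : d = e
      · simp [h1, h.next_left, h.p_inl, h.p_u]
      by_cases h2 : d = X.opp e
      · simp [h2, h.next_right, h.p_inl, h.p_v]
      simpa [h.next_of_ne d h1 h2, h.p_inl] using hF d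
    · simpa [h.next_u, h.p_inl, h.p_u] using hF e
    · simpa [h.next_v, h.p_inl, h.p_v] using hF (X.opp e)

theorem sameCycle_iff {x y : Y.Dart} :
    Y.next.SameCycle x y ↔ X.next.SameCycle (p x) (p y) := by
  constructor
  · intro hxy
    have hF : FaceClosed {d | X.next.SameCycle (p x) d} := fun d =>
      Equiv.Perm.sameCycle_apply_right
    exact ((h.faceClosed_iff.2 hF).mem_iff_of_sameCycle hxy).1 (Equiv.Perm.SameCycle.refl _ _)
  · intro hxy
    have hinl : ∀ d, Y.next.SameCycle (ι d) (ι (X.next d)) := by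
      intro d
      by_cases h1 : d = e
      · rw [h1, ← h.next_u, ← h.next_left, Equiv.Perm.sameCycle_apply_right,
          Equiv.Perm.sameCycle_apply_right]
      by_cases h2 : d = X.opp e
      · rw [h2, ← h.next_v, ← h.next_right, Equiv.Perm.sameCycle_apply_right,
          Equiv.Perm.sameCycle_apply_right]
      rw [← h.next_of_ne d h1 h2, Equiv.Perm.sameCycle_apply_right]
    have hproj : ∀ x, Y.next.SameCycle (ι (p x)) x := by
      intro x
      rcases h.cases x with ⟨d, rfl⟩ | rfl | rfl
      · rw [h.p_inl]
      · rw [h.p_u]; rw [← h.next_left, Equiv.Perm.sameCycle_apply_right]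
      · rw [h.p_v]; rw [← h.next_right, Equiv.Perm.sameCycle_apply_right]
    refine (hproj x).symm.trans (Equiv.Perm.SameCycle.trans ?_ (hproj y))
    obtain ⟨n, hn⟩ := hxy.exists_nat_pow_eq
    rw [← hn]
    clear hn
    induction n with
    | zero => exact .refl _ _
    | succ n ih => rw [pow_succ', Equiv.Perm.mul_apply]; exact ih.trans (hinl _)

theorem vertexStep_iff {d : X.Dart} {y : Y.Dart} :
    Y.VertexStep (ι d) y ↔ ∃ d', X.VertexStep d d' ∧ y = ι d' := by
  unfold VertexStep
  by_cases h1 : d = e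
  · subst h1
    rw [h.opp_left, h.next_v]
    constructor
    · rintro ⟨-, rfl⟩
      exact ⟨_, ⟨h.opp_ne, rfl⟩, rfl⟩
    · rintro ⟨_, ⟨-, rfl⟩, rfl⟩
      exact ⟨(h.inl_ne_v _).symm, rfl⟩
  by_cases h2 : d = X.opp e
  · subst h2
    rw [h.opp_right, h.next_u, X.opp_opp]
    constructor
    · rintro ⟨-, rfl⟩
      exact ⟨_, ⟨h.opp_ne.symm, rfl⟩, rfl⟩
    · rintro ⟨_, ⟨-, rfl⟩, rfl⟩
      exact ⟨(h.inl_ne_u _).symm, rfl⟩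
  have h3 : X.opp d ≠ e := fun h => h2 (by rw [← h, X.opp_opp])
  have h4 : X.opp d ≠ X.opp e := fun h => h1 (X.opp.injective h)
  rw [h.opp_of_ne d h1 h2, h.next_of_ne _ h3 h4, h.injective.ne_iff]
  constructor
  · rintro ⟨h, rfl⟩
    exact ⟨_, ⟨h, rfl⟩, rfl⟩
  · rintro ⟨_, ⟨h, rfl⟩, rfl⟩
    exact ⟨h, rfl⟩

/-- The vertices of `Y` are those of `X` and one new vertex. -/
theorem sameVertex_cases {x y : Y.Dart} (hxy : Y.SameVertex x y) :
    (∃ d d', x = ι d ∧ y = ι d' ∧ X.SameVertex d d') ∨ ((x = u ∨ x = v) ∧ (y = u ∨ y = v)) := by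
  induction hxy with
  | rel x y hxy =>
    rcases h.cases x with ⟨d, rfl⟩ | rfl | rfl
    · obtain ⟨d', hd, rfl⟩ := h.vertexStep_iff.1 hxy
      exact Or.inl ⟨d, d', rfl, rfl, EqvGen.rel _ _ hd⟩
    · obtain ⟨-, rfl⟩ := hxy
      exact Or.inr ⟨Or.inl rfl, Or.inr (by rw [h.opp_u, h.next_right])⟩
    · obtain ⟨-, rfl⟩ := hxy
      exact Or.inr ⟨Or.inr rfl, Or.inl (by rw [h.opp_v, h.next_left])⟩
  | refl x =>
    rcases h.cases x with ⟨d, rfl⟩ | hx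
    · exact Or.inl ⟨d, d, rfl, rfl, .refl d⟩
    · exact Or.inr ⟨hx, hx⟩
  | symm x y _ ih =>
    rcases ih with ⟨d, d', rfl, rfl, h⟩ | ⟨hx, hy⟩
    · exact Or.inl ⟨d', d, rfl, rfl, h.symm⟩
    · exact Or.inr ⟨hy, hx⟩
  | trans x y z _ _ ih ih' =>
    rcases ih with ⟨d, d', rfl, rfl, h1⟩ | ⟨hx, hy⟩
    · rcases ih' with ⟨a, a', ha, rfl, h'⟩ | ⟨hb | hb, -⟩
      · cases h.injective ha
        exact Or.inl ⟨d, a', rfl, rfl, h1.trans h'⟩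
      · exact (h.inl_ne_u _ hb).elim
      · exact (h.inl_ne_v _ hb).elim
    · rcases ih' with ⟨a, a', rfl, rfl, h'⟩ | ⟨-, hz⟩
      · rcases hy with hb | hb
        · exact (h.inl_ne_u _ hb).elim
        · exact (h.inl_ne_v _ hb).elim
      · exact Or.inr ⟨hx, hz⟩

theorem sameVertex_iff {d d' : X.Dart} : Y.SameVertex (ι d) (ι d') ↔ X.SameVertex d d' := by
  constructor
  · intro hd
    rcases h.sameVertex_cases hd with ⟨a, a', ha, ha', haa⟩ | ⟨hb | hb, -⟩
    · cases h.injective ha; cases h.injective ha'; exact haa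
    · exact (h.inl_ne_u _ hb).elim
    · exact (h.inl_ne_v _ hb).elim
  · intro hd
    induction hd with
    | rel x y hxy => exact EqvGen.rel _ _ (h.vertexStep_iff.2 ⟨y, hxy, rfl⟩)
    | refl => exact .refl _
    | symm _ _ _ ih => exact ih.symm
    | trans _ _ _ _ _ ih ih' => exact ih.trans ih'

theorem sameVertex_new : Y.SameVertex u v := by
  refine EqvGen.rel _ _ ⟨?_, ?_⟩
  · rw [h.opp_u]; exact h.inl_ne_u _
  · rw [h.opp_u, h.next_right]

theorem euler_preimage (F : Set X.Dart) : Y.euler (p ⁻¹' F) = X.euler F := by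
  have hf : (faces (p ⁻¹' F)).ncard = (faces F).ncard := by
    rw [faces, faces, ncard_image_comp (p := p) (g := Quot.mk X.next.SameCycle) fun a _ b _ => by
      rw [mk_eq_iff_sameCycle, mk_eq_iff_sameCycle, h.sameCycle_iff],
      Set.image_preimage_eq F fun d => ⟨ι d, h.p_inl d⟩]
  have hv0 : (verts (ι '' F)).ncard = (verts F).ncard :=
    (ncard_image_comp fun a _ b _ => by
      rw [mk_eq_iff_sameVertex, mk_eq_iff_sameVertex, h.sameVertex_iff]).symm
  -- The edges other than the subdivided one are not affected.
  have he0 : (edges (ι '' (F \ {e, X.opp e}))).ncard = (edges (F \ {e, X.opp e})).ncard := by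
    refine (ncard_image_comp fun a ha b hb => ?_).symm
    rw [edge_eq_iff, edge_eq_iff, h.opp_of_ne b (fun h => hb.2 (Or.inl h))
      (fun h => hb.2 (Or.inr h)), h.injective.eq_iff, h.injective.eq_iff]
  rw [euler_eq, euler_eq, hf]
  by_cases hF : e ∈ F ∨ X.opp e ∈ F
  · have hv : verts (p ⁻¹' F) = insert (Quot.mk _ u) (verts (ι '' F)) := by
      ext y
      constructor
      · rintro ⟨y, hy, rfl⟩
        rcases h.cases y with ⟨d, rfl⟩ | rfl | rfl
        · exact Or.inr ⟨_, ⟨d, by simpa [h.p_inl] using hy, rfl⟩, rfl⟩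
        · exact Or.inl rfl
        · exact Or.inl (mk_eq_iff_sameVertex.2 h.sameVertex_new.symm)
      · rintro (rfl | ⟨_, ⟨d, hd, rfl⟩, rfl⟩)
        · rcases hF with hF | hF
          · exact ⟨u, by simpa [h.p_u] using hF, rfl⟩
          · exact ⟨v, by simpa [h.p_v] using hF, mk_eq_iff_sameVertex.2 h.sameVertex_new.symm⟩
        · exact ⟨_, by simpa [h.p_inl] using hd, rfl⟩
    have hv1 : Quot.mk _ u ∉ verts (ι '' F) := by
      rintro ⟨_, ⟨d, -, rfl⟩, hd⟩
      rcases h.sameVertex_cases (mk_eq_iff_sameVertex.1 hd) with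
        ⟨_, d', _, hu, _⟩ | ⟨hu | hu, _⟩
      exacts [h.inl_ne_u _ hu.symm, h.inl_ne_u _ hu, h.inl_ne_v _ hu]
    have he1 : edges (p ⁻¹' F) = insert s(u, Y.opp u) (insert s(v, Y.opp v)
        (edges (ι '' (F \ {e, X.opp e})))) := by
      ext y
      constructor
      · rintro ⟨y, hy, rfl⟩
        rcases h.cases y with ⟨d, rfl⟩ | rfl | rfl
        · by_cases h1 : d = e
          · exact Or.inr (Or.inl (edge_eq_iff.2 (Or.inr (by rw [h1, h.opp_v]))))
          by_cases h2 : d = X.opp e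
          · exact Or.inl (edge_eq_iff.2 (Or.inr (by rw [h2, h.opp_u])))
          exact Or.inr (Or.inr ⟨_, ⟨d, ⟨by simpa [h.p_inl] using hy,
            by rintro (h | h) <;> contradiction⟩, rfl⟩, rfl⟩)
        · exact Or.inl rfl
        · exact Or.inr (Or.inl rfl)
      · rintro (rfl | rfl | ⟨_, ⟨d, hd, rfl⟩, rfl⟩)
        · exact mem_edges.2 (by simpa [h.p_u, h.opp_u, h.p_inl] using hF)
        · exact mem_edges.2 (by simpa [h.p_v, h.opp_v, h.p_inl] using hF.symm)
        · exact ⟨_, by simpa [h.p_inl] using hd.1, rfl⟩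
    have he2 : s(v, Y.opp v) ∉ edges (ι '' (F \ {e, X.opp e})) := by
      rw [mem_edges, h.opp_v]
      rintro (⟨d, -, hd⟩ | ⟨d, hd, hd'⟩)
      · exact h.inl_ne_v _ hd
      · exact hd.2 (Or.inl (h.injective hd'))
    have he3 : s(u, Y.opp u) ∉ insert s(v, Y.opp v) (edges (ι '' (F \ {e, X.opp e}))) := by
      rintro (hu | hu)
      · rcases edge_eq_iff.1 hu with hu | hu
        · exact h.opp_ne (by rw [← h.p_v, ← hu, h.p_u])
        · exact h.inl_ne_u _ (by rw [hu, h.opp_v])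
      rw [mem_edges, h.opp_u] at hu
      rcases hu with ⟨d, -, hd⟩ | ⟨d, hd, hd'⟩
      · exact h.inl_ne_u _ hd
      · exact hd.2 (Or.inr (h.injective hd'))
    have he4 : edges F = insert s(e, X.opp e) (edges (F \ {e, X.opp e})) := by
      ext y
      constructor
      · rintro ⟨d, hd, rfl⟩
        by_cases h : d = e ∨ d = X.opp e
        · exact Or.inl (edge_eq_iff.2 h)
        · exact Or.inr ⟨d, ⟨hd, h⟩, rfl⟩
      · rintro (rfl | ⟨d, hd, rfl⟩)
        · exact mem_edges.2 hF
        · exact ⟨d, hd.1, rfl⟩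
    have he5 : s(e, X.opp e) ∉ edges (F \ {e, X.opp e}) := by
      rw [mem_edges]
      rintro (h | h)
      exacts [h.2 (Or.inl rfl), h.2 (Or.inr rfl)]
    rw [hv, he1, he4, Set.ncard_insert_of_notMem hv1, Set.ncard_insert_of_notMem he3,
      Set.ncard_insert_of_notMem he2, Set.ncard_insert_of_notMem he5, hv0, he0]
    push_cast
    ring
  · have hset : p ⁻¹' F = ι '' F := by
      ext x
      constructor
      · intro hx
        rcases h.cases x with ⟨d, rfl⟩ | rfl | rfl
        · exact ⟨d, by simpa [h.p_inl] using hx, rfl⟩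
        · exact (hF (Or.inl (by simpa [h.p_u] using hx))).elim
        · exact (hF (Or.inr (by simpa [h.p_v] using hx))).elim
      · rintro ⟨d, hd, rfl⟩
        simpa [h.p_inl] using hd
    have hdiff : F \ {e, X.opp e} = F := by
      ext d
      refine ⟨fun hd => hd.1, fun hd => ⟨hd, ?_⟩⟩
      rintro (rfl | rfl)
      exacts [hF (Or.inl hd), hF (Or.inr hd)]
    rw [hdiff] at he0
    rw [hset, hv0, he0]

end IsEdgeSplit

theorem isEdgeSplit_splitEdge (e : X.Dart) (he : X.opp e ≠ e) :
    IsEdgeSplit e (Y := X.splitEdge e he) (Sum.inl : X.Dart → X.Dart ⊕ Bool)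
      (Sum.inr true : X.Dart ⊕ Bool) (Sum.inr false : X.Dart ⊕ Bool)
      (fun d : X.Dart ⊕ Bool => Sum.elim id (fun t => if t then e else X.opp e) d) := by
  have hne : (Sum.inl e : X.Dart ⊕ Bool) ≠ Sum.inl (X.opp e) := by simpa using he.symm
  -- The permutations `opp` and `next` of the subdivided surface.
  let o : Equiv.Perm (X.Dart ⊕ Bool) := Equiv.swap (Sum.inl (X.opp e)) (Sum.inr false)
    * Equiv.sumCongr X.opp Equiv.boolNot * Equiv.swap (Sum.inl (X.opp e)) (Sum.inr false)
  let n : Equiv.Perm (X.Dart ⊕ Bool) := Equiv.sumCongr X.next (Equiv.refl Bool)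
    * Equiv.swap (Sum.inl e) (Sum.inr true) * Equiv.swap (Sum.inl (X.opp e)) (Sum.inr false)
  refine
    { opp_ne := he
      cases := ?_
      p_inl := fun _ => rfl
      p_u := rfl
      p_v := rfl
      inl_ne_u := fun _ => Sum.inl_ne_inr
      inl_ne_v := fun _ => Sum.inl_ne_inr
      opp_left := show o (Sum.inl e) = Sum.inr false from ?_
      opp_right := show o (Sum.inl (X.opp e)) = Sum.inr true from ?_
      opp_u := show o (Sum.inr true) = Sum.inl (X.opp e) from ?_
      opp_v := show o (Sum.inr false) = Sum.inl e from ?_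
      opp_of_ne := fun d hd hd' => show o (Sum.inl d) = Sum.inl (X.opp d) from ?_
      next_left := show n (Sum.inl e) = Sum.inr true from ?_
      next_right := show n (Sum.inl (X.opp e)) = Sum.inr false from ?_
      next_u := show n (Sum.inr true) = Sum.inl (X.next e) from ?_
      next_v := show n (Sum.inr false) = Sum.inl (X.next (X.opp e)) from ?_
      next_of_ne := fun d hd hd' => show n (Sum.inl d) = Sum.inl (X.next d) from ?_ }
  · rintro (d | (_ | _))
    exacts [Or.inl ⟨d, rfl⟩, Or.inr (Or.inr rfl), Or.inr (Or.inl rfl)]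
  · simp [o, Equiv.swap_apply_of_ne_of_ne hne]
  · simp [o, Equiv.swap_apply_of_ne_of_ne]
  · simp [o, Equiv.swap_apply_of_ne_of_ne]
  · simp [o, X.opp_opp, Equiv.swap_apply_of_ne_of_ne hne]
  · have h1 : (Sum.inl d : X.Dart ⊕ Bool) ≠ Sum.inl (X.opp e) := by simpa using hd'
    have h2 : (Sum.inl (X.opp d) : X.Dart ⊕ Bool) ≠ Sum.inl (X.opp e) := by simpa using hd
    simp [o, Equiv.swap_apply_of_ne_of_ne h1, Equiv.swap_apply_of_ne_of_ne h2]
  · simp [n, Equiv.swap_apply_of_ne_of_ne hne]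
  · simp [n, Equiv.swap_apply_of_ne_of_ne]
  · simp [n, Equiv.swap_apply_of_ne_of_ne]
  · simp [n, Equiv.swap_apply_of_ne_of_ne hne.symm]
  · have h1 : (Sum.inl d : X.Dart ⊕ Bool) ≠ Sum.inl (X.opp e) := by simpa using hd'
    have h2 : (Sum.inl d : X.Dart ⊕ Bool) ≠ Sum.inl e := by simpa using hd
    simp [n, Equiv.swap_apply_of_ne_of_ne h1, Equiv.swap_apply_of_ne_of_ne h2]

/-- The cell structure `Y` arises from `X` by subdividing the boundary edge `e`: a dart `d` survives
as `ι d`, and `ι e` is followed by `u`; `p` sends a dart of `Y` to the dart of `X` that contains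
it. -/
structure IsBoundarySplit (e : X.Dart) {Y : MarkedSurface} (ι : X.Dart → Y.Dart) (u : Y.Dart)
    (p : Y.Dart → X.Dart) : Prop where
  opp_eq : X.opp e = e
  cases : ∀ y, (∃ d, y = ι d) ∨ y = u
  p_inl : ∀ d, p (ι d) = d
  p_u : p u = e
  inl_ne_u : ∀ d, ι d ≠ u
  opp_inl : ∀ d, Y.opp (ι d) = ι (X.opp d)
  opp_u : Y.opp u = u
  next_left : Y.next (ι e) = u
  next_u : Y.next u = ι (X.next e)
  next_of_ne : ∀ d, d ≠ e → Y.next (ι d) = ι (X.next d)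

namespace IsBoundarySplit

variable {e : X.Dart} {Y : MarkedSurface} {ι : X.Dart → Y.Dart} {u : Y.Dart}
  {p : Y.Dart → X.Dart} (h : IsBoundarySplit e ι u p)
include h

theorem injective : Function.Injective ι := fun a b hab => by
  rw [← h.p_inl a, hab, h.p_inl]

theorem faceClosed_iff {F : Set X.Dart} : FaceClosed (p ⁻¹' F) ↔ FaceClosed F := by
  constructor
  · intro hF d
    by_cases h1 : d = e
    · simpa [h.next_u, h.p_inl, h.p_u, h1] using hF u
    simpa [h.next_of_ne d h1, h.p_inl] using hF (ι d)
  · intro hF y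
    rcases h.cases y with ⟨d, rfl⟩ | rfl
    · by_cases h1 : d = e
      · simp [h1, h.next_left, h.p_inl, h.p_u]
      simpa [h.next_of_ne d h1, h.p_inl] using hF d
    · simpa [h.next_u, h.p_inl, h.p_u] using hF e

theorem sameCycle_iff {x y : Y.Dart} :
    Y.next.SameCycle x y ↔ X.next.SameCycle (p x) (p y) := by
  constructor
  · intro hxy
    have hF : FaceClosed {d | X.next.SameCycle (p x) d} := fun d =>
      Equiv.Perm.sameCycle_apply_right
    exact ((h.faceClosed_iff.2 hF).mem_iff_of_sameCycle hxy).1 (Equiv.Perm.SameCycle.refl _ _)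
  · intro hxy
    have hinl : ∀ d, Y.next.SameCycle (ι d) (ι (X.next d)) := by
      intro d
      by_cases h1 : d = e
      · rw [h1, ← h.next_u, ← h.next_left, Equiv.Perm.sameCycle_apply_right,
          Equiv.Perm.sameCycle_apply_right]
      rw [← h.next_of_ne d h1, Equiv.Perm.sameCycle_apply_right]
    have hproj : ∀ x, Y.next.SameCycle (ι (p x)) x := by
      intro x
      rcases h.cases x with ⟨d, rfl⟩ | rfl
      · rw [h.p_inl]
      · rw [h.p_u]; rw [← h.next_left, Equiv.Perm.sameCycle_apply_right]
    refine (hproj x).symm.trans (Equiv.Perm.SameCycle.trans ?_ (hproj y))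
    obtain ⟨n, hn⟩ := hxy.exists_nat_pow_eq
    rw [← hn]
    clear hn
    induction n with
    | zero => exact .refl _ _
    | succ n ih => rw [pow_succ', Equiv.Perm.mul_apply]; exact ih.trans (hinl _)

theorem vertexStep_iff {d : X.Dart} {y : Y.Dart} :
    Y.VertexStep (ι d) y ↔ ∃ d', X.VertexStep d d' ∧ y = ι d' := by
  unfold VertexStep
  rw [h.opp_inl, h.injective.ne_iff]
  constructor
  · rintro ⟨hd, rfl⟩
    refine ⟨_, ⟨hd, rfl⟩, h.next_of_ne _ fun hde => hd ?_⟩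
    have hd' : d = e := by rw [← X.opp_opp d, hde, h.opp_eq]
    rw [hde, hd']
  · rintro ⟨_, ⟨hd, rfl⟩, rfl⟩
    refine ⟨hd, (h.next_of_ne _ fun hde => hd ?_).symm⟩
    have hd' : d = e := by rw [← X.opp_opp d, hde, h.opp_eq]
    rw [hde, hd']

/-- The vertices of `Y` are those of `X` and one new vertex. -/
theorem sameVertex_cases {x y : Y.Dart} (hxy : Y.SameVertex x y) :
    (∃ d d', x = ι d ∧ y = ι d' ∧ X.SameVertex d d') ∨ (x = u ∧ y = u) := by
  induction hxy with
  | rel x y hxy =>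
    rcases h.cases x with ⟨d, rfl⟩ | rfl
    · obtain ⟨d', hd, rfl⟩ := h.vertexStep_iff.1 hxy
      exact Or.inl ⟨d, d', rfl, rfl, EqvGen.rel _ _ hd⟩
    · exact (hxy.1 h.opp_u).elim
  | refl x =>
    rcases h.cases x with ⟨d, rfl⟩ | hx
    · exact Or.inl ⟨d, d, rfl, rfl, .refl d⟩
    · exact Or.inr ⟨hx, hx⟩
  | symm x y _ ih =>
    rcases ih with ⟨d, d', rfl, rfl, h⟩ | ⟨hx, hy⟩
    · exact Or.inl ⟨d', d, rfl, rfl, h.symm⟩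
    · exact Or.inr ⟨hy, hx⟩
  | trans x y z _ _ ih ih' =>
    rcases ih with ⟨d, d', rfl, rfl, h1⟩ | ⟨hx, hy⟩
    · rcases ih' with ⟨a, a', ha, rfl, h'⟩ | ⟨hb, -⟩
      · cases h.injective ha
        exact Or.inl ⟨d, a', rfl, rfl, h1.trans h'⟩
      · exact (h.inl_ne_u _ hb).elim
    · rcases ih' with ⟨a, a', rfl, rfl, h'⟩ | ⟨-, hz⟩
      · exact (h.inl_ne_u _ hy).elim
      · exact Or.inr ⟨hx, hz⟩

theorem sameVertex_iff {d d' : X.Dart} : Y.SameVertex (ι d) (ι d') ↔ X.SameVertex d d' := by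
  constructor
  · intro hd
    rcases h.sameVertex_cases hd with ⟨a, a', ha, ha', haa⟩ | ⟨hb, -⟩
    · cases h.injective ha; cases h.injective ha'; exact haa
    · exact (h.inl_ne_u _ hb).elim
  · intro hd
    induction hd with
    | rel x y hxy => exact EqvGen.rel _ _ (h.vertexStep_iff.2 ⟨y, hxy, rfl⟩)
    | refl => exact .refl _
    | symm _ _ _ ih => exact ih.symm
    | trans _ _ _ _ _ ih ih' => exact ih.trans ih'

theorem euler_preimage (F : Set X.Dart) : Y.euler (p ⁻¹' F) = X.euler F := by
  have hf : (faces (p ⁻¹' F)).ncard = (faces F).ncard := by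
    rw [faces, faces, ncard_image_comp (p := p) (g := Quot.mk X.next.SameCycle) fun a _ b _ => by
      rw [mk_eq_iff_sameCycle, mk_eq_iff_sameCycle, h.sameCycle_iff],
      Set.image_preimage_eq F fun d => ⟨ι d, h.p_inl d⟩]
  have hv0 : (verts (ι '' F)).ncard = (verts F).ncard :=
    (ncard_image_comp fun a _ b _ => by
      rw [mk_eq_iff_sameVertex, mk_eq_iff_sameVertex, h.sameVertex_iff]).symm
  have he0 : (edges (ι '' F)).ncard = (edges F).ncard := by
    refine (ncard_image_comp fun a ha b hb => ?_).symm
    rw [edge_eq_iff, edge_eq_iff, h.opp_inl, h.injective.eq_iff, h.injective.eq_iff]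
  rw [euler_eq, euler_eq, hf]
  by_cases hF : e ∈ F
  · have hset : p ⁻¹' F = insert u (ι '' F) := by
      ext x
      constructor
      · intro hx
        rcases h.cases x with ⟨d, rfl⟩ | rfl
        · exact Or.inr ⟨d, by simpa [h.p_inl] using hx, rfl⟩
        · exact Or.inl rfl
      · rintro (rfl | ⟨d, hd, rfl⟩)
        · simpa [h.p_u] using hF
        · simpa [h.p_inl] using hd
    have hv1 : Quot.mk _ u ∉ verts (ι '' F) := by
      rintro ⟨_, ⟨d, -, rfl⟩, hd⟩
      rcases h.sameVertex_cases (mk_eq_iff_sameVertex.1 hd) with ⟨_, d', _, hu, _⟩ | ⟨hu, _⟩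
      exacts [h.inl_ne_u _ hu.symm, h.inl_ne_u _ hu]
    have he1 : s(u, Y.opp u) ∉ edges (ι '' F) := by
      rw [mem_edges, h.opp_u, or_self]
      rintro ⟨d, -, hd⟩
      exact h.inl_ne_u _ hd
    have hv : verts (insert u (ι '' F)) = insert (Quot.mk _ u) (verts (ι '' F)) :=
      Set.image_insert_eq
    have he : edges (insert u (ι '' F)) = insert s(u, Y.opp u) (edges (ι '' F)) :=
      Set.image_insert_eq
    rw [hset, hv, he, Set.ncard_insert_of_notMem hv1, Set.ncard_insert_of_notMem he1, hv0, he0]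
    push_cast
    ring
  · have hset : p ⁻¹' F = ι '' F := by
      ext x
      constructor
      · intro hx
        rcases h.cases x with ⟨d, rfl⟩ | rfl
        · exact ⟨d, by simpa [h.p_inl] using hx, rfl⟩
        · exact (hF (by simpa [h.p_u] using hx)).elim
      · rintro ⟨d, hd, rfl⟩
        simpa [h.p_inl] using hd
    rw [hset, hv0, he0]

end IsBoundarySplit

theorem isBoundarySplit_splitBoundary (e : X.Dart) (he : X.opp e = e) :
    IsBoundarySplit e (Y := X.splitBoundary e) (Sum.inl : X.Dart → X.Dart ⊕ Unit)
      (Sum.inr () : X.Dart ⊕ Unit) (fun d : X.Dart ⊕ Unit => Sum.elim id (fun _ => e) d) := by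
  let n : Equiv.Perm (X.Dart ⊕ Unit) :=
    Equiv.sumCongr X.next (Equiv.refl Unit) * Equiv.swap (Sum.inl e) (Sum.inr ())
  refine
    { opp_eq := he
      cases := ?_
      p_inl := fun _ => rfl
      p_u := rfl
      inl_ne_u := fun _ => Sum.inl_ne_inr
      opp_inl := fun _ => rfl
      opp_u := rfl
      next_left := show n (Sum.inl e) = Sum.inr () from ?_
      next_u := show n (Sum.inr ()) = Sum.inl (X.next e) from ?_
      next_of_ne := fun d hd => show n (Sum.inl d) = Sum.inl (X.next d) from ?_ }
  · rintro (d | _)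
    exacts [Or.inl ⟨d, rfl⟩, Or.inr rfl]
  · simp [n]
  · simp [n]
  · have h2 : (Sum.inl d : X.Dart ⊕ Unit) ≠ Sum.inl e := by simpa using hd
    simp [n, Equiv.swap_apply_of_ne_of_ne h2]

end MarkedSurface

namespace MarkedSurface

variable {X : MarkedSurface}

/-- The cell structure `Y` arises from `X` by subdividing a face by a diagonal from the initial
vertex of `a` to that of `b`: a dart `d` survives as `ι d`, and the new darts are `u`, which is
followed by `ι b`, and `v`, which is followed by `ι a`; `p` sends the new darts to `a`. -/
structure IsFaceSplit (a b : X.Dart) {Y : MarkedSurface} (ι : X.Dart → Y.Dart) (u v : Y.Dart)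
    (p : Y.Dart → X.Dart) : Prop where
  ne : a ≠ b
  sameCycle : X.next.SameCycle a b
  cases : ∀ y, (∃ d, y = ι d) ∨ y = u ∨ y = v
  p_inl : ∀ d, p (ι d) = d
  p_u : p u = a
  p_v : p v = a
  inl_ne_u : ∀ d, ι d ≠ u
  inl_ne_v : ∀ d, ι d ≠ v
  u_ne_v : u ≠ v
  opp_inl : ∀ d, Y.opp (ι d) = ι (X.opp d)
  opp_u : Y.opp u = v
  opp_v : Y.opp v = u
  next_u : Y.next u = ι b
  next_v : Y.next v = ι a
  next_of_eq_left : ∀ d, X.next d = a → Y.next (ι d) = u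
  next_of_eq_right : ∀ d, X.next d = b → Y.next (ι d) = v
  next_of_ne : ∀ d, X.next d ≠ a → X.next d ≠ b → Y.next (ι d) = ι (X.next d)

namespace IsFaceSplit

variable {a b : X.Dart} {Y : MarkedSurface} {ι : X.Dart → Y.Dart} {u v : Y.Dart}
  {p : Y.Dart → X.Dart} (h : IsFaceSplit a b ι u v p)
include h

theorem injective : Function.Injective ι := fun c d hcd => by
  rw [← h.p_inl c, hcd, h.p_inl]

theorem faceClosed_iff {F : Set X.Dart} : FaceClosed (p ⁻¹' F) ↔ FaceClosed F := by
  constructor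
  · intro hF
    have hab : b ∈ F ↔ a ∈ F := by simpa [h.next_u, h.p_inl, h.p_u] using hF u
    intro d
    by_cases h1 : X.next d = a
    · simpa [h.next_of_eq_left d h1, h.p_inl, h.p_u, h1] using hF (ι d)
    by_cases h2 : X.next d = b
    · simpa [h.next_of_eq_right d h2, h.p_inl, h.p_v, h2, hab] using hF (ι d)
    simpa [h.next_of_ne d h1 h2, h.p_inl] using hF (ι d)
  · intro hF y
    have hab : a ∈ F ↔ b ∈ F := hF.mem_iff_of_sameCycle h.sameCycle
    rcases h.cases y with ⟨d, rfl⟩ | rfl | rfl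
    · by_cases h1 : X.next d = a
      · simpa [h.next_of_eq_left d h1, h.p_inl, h.p_u, h1] using hF d
      by_cases h2 : X.next d = b
      · simpa [h.next_of_eq_right d h2, h.p_inl, h.p_v, h2, hab] using hF d
      simpa [h.next_of_ne d h1 h2, h.p_inl] using hF d
    · simp [h.next_u, h.p_inl, h.p_u, hab]
    · simp [h.next_v, h.p_inl, h.p_v]

theorem sameCycle_of_sameCycle {x y : Y.Dart} (hxy : Y.next.SameCycle x y) :
    X.next.SameCycle (p x) (p y) := by
  have hF : FaceClosed {d | X.next.SameCycle (p x) d} := fun d =>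
    Equiv.Perm.sameCycle_apply_right
  exact ((h.faceClosed_iff.2 hF).mem_iff_of_sameCycle hxy).1 (Equiv.Perm.SameCycle.refl _ _)

/-- The faces that are not subdivided remain the same. -/
theorem sameCycle_iff {x y : X.Dart} (hx : ¬ X.next.SameCycle a x) :
    Y.next.SameCycle (ι x) (ι y) ↔ X.next.SameCycle x y := by
  constructor
  · intro hxy
    simpa [h.p_inl] using h.sameCycle_of_sameCycle hxy
  · intro hxy
    obtain ⟨n, rfl⟩ := hxy.exists_nat_pow_eq
    clear hxy
    induction n with
    | zero => exact .refl _ _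
    | succ n ih =>
      refine ih.trans ?_
      rw [pow_succ', Equiv.Perm.mul_apply]
      have h0 : X.next.SameCycle x (X.next ((X.next ^ n) x)) :=
        Equiv.Perm.sameCycle_apply_right.2 ⟨n, by simp⟩
      rw [← h.next_of_ne, Equiv.Perm.sameCycle_apply_right]
      · intro h1; rw [h1] at h0; exact hx h0.symm
      · intro h1; rw [h1] at h0; exact hx (h.sameCycle.trans h0.symm)

/-- The subdivided face consists of two faces of `Y`. -/
theorem sameCycle_u_or_v {x : Y.Dart} (hx : X.next.SameCycle a (p x)) :
    Y.next.SameCycle u x ∨ Y.next.SameCycle v x := by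
  have key : ∀ n : ℕ, Y.next.SameCycle u (ι ((X.next ^ n) a)) ∨
      Y.next.SameCycle v (ι ((X.next ^ n) a)) := by
    intro n
    induction n with
    | zero =>
      refine Or.inr ?_
      rw [pow_zero, Equiv.Perm.one_apply, ← h.next_v, Equiv.Perm.sameCycle_apply_right]
    | succ n ih =>
      rw [pow_succ', Equiv.Perm.mul_apply]
      by_cases h1 : X.next ((X.next ^ n) a) = a
      · rw [h1]
        refine Or.inr ?_
        rw [← h.next_v, Equiv.Perm.sameCycle_apply_right]
      by_cases h2 : X.next ((X.next ^ n) a) = b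
      · rw [h2]
        refine Or.inl ?_
        rw [← h.next_u, Equiv.Perm.sameCycle_apply_right]
      rw [← h.next_of_ne _ h1 h2, Equiv.Perm.sameCycle_apply_right,
        Equiv.Perm.sameCycle_apply_right]
      exact ih
  rcases h.cases x with ⟨d, rfl⟩ | rfl | rfl
  · rw [h.p_inl] at hx
    obtain ⟨n, rfl⟩ := hx.exists_nat_pow_eq
    exact key n
  · exact Or.inl (.refl _ _)
  · exact Or.inr (.refl _ _)

theorem not_sameCycle_u_v : ¬ Y.next.SameCycle v u := by
  classical
  have hex : ∃ n : ℕ, X.next^[n] a = b := by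
    obtain ⟨n, hn⟩ := h.sameCycle.exists_nat_pow_eq
    exact ⟨n, by rw [Equiv.Perm.iterate_eq_pow]; exact hn⟩
  -- The sides of the face from `a` up to the first occurrence of `b`, closed up by `v`.
  let m := Nat.find hex
  have hm : X.next^[m] a = b := Nat.find_spec hex
  have hmin : ∀ i < m, X.next^[i] a ≠ b := fun i hi => Nat.find_min hex hi
  have hm0 : 0 < m := Nat.pos_of_ne_zero fun h0 => h.ne (by rw [h0] at hm; exact hm)
  have hU : FaceClosed (insert v {y | ∃ i < m, y = ι (X.next^[i] a)}) := by
    refine faceClosed_of_mapsTo ?_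
    rintro y (rfl | ⟨i, hi, rfl⟩)
    · exact Or.inr ⟨0, hm0, h.next_v⟩
    · have hs : X.next (X.next^[i] a) = X.next^[i + 1] a :=
        (Function.iterate_succ_apply' X.next i a).symm
      have h1 : X.next (X.next^[i] a) ≠ a := by
        intro h1
        refine hmin (m - (i + 1)) (by omega) ?_
        conv_lhs => rw [← h1, hs]
        rw [← Function.iterate_add_apply, Nat.sub_add_cancel hi, hm]
      by_cases h2 : X.next (X.next^[i] a) = b
      · exact Or.inl (h.next_of_eq_right _ h2)
      · refine Or.inr ⟨i + 1, ?_, by rw [h.next_of_ne _ h1 h2, hs]⟩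
        rcases Nat.lt_or_eq_of_le (Nat.succ_le_of_lt hi) with hlt | heq
        · exact hlt
        · exact (h2 (by rw [hs, ← hm]; exact congrArg (fun j => X.next^[j] a) heq)).elim
  intro hvu
  rcases (hU.mem_iff_of_sameCycle hvu).1 (Or.inl rfl) with huv | ⟨i, -, hu⟩
  · exact h.u_ne_v huv
  · exact h.inl_ne_u _ hu.symm

theorem sameVertex_u : Y.SameVertex u (ι a) := by
  refine EqvGen.rel _ _ ⟨?_, ?_⟩
  · rw [h.opp_u]; exact h.u_ne_v.symm
  · rw [h.opp_u, h.next_v]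

theorem sameVertex_v : Y.SameVertex v (ι b) := by
  refine EqvGen.rel _ _ ⟨?_, ?_⟩
  · rw [h.opp_v]; exact h.u_ne_v
  · rw [h.opp_v, h.next_u]

theorem sameVertex_iff {d d' : X.Dart} : Y.SameVertex (ι d) (ι d') ↔ X.SameVertex d d' := by
  classical
  constructor
  · -- The initial vertices of `u` and `v` are those of `a` and `b`.
    let q : Y.Dart → X.Dart := fun y => if y = u then a else if y = v then b else p y
    have qu : q u = a := by simp [q]
    have qv : q v = b := by simp [q, h.u_ne_v.symm]
    have qi : ∀ d, q (ι d) = d := fun d => by simp [q, h.inl_ne_u, h.inl_ne_v, h.p_inl]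
    have key : ∀ {x y}, Y.SameVertex x y → X.SameVertex (q x) (q y) := by
      intro x y hxy
      induction hxy with
      | rel x y hxy =>
        obtain ⟨hx, rfl⟩ := hxy
        rcases h.cases x with ⟨d, rfl⟩ | rfl | rfl
        · rw [h.opp_inl, h.injective.ne_iff] at hx
          have hd := sameVertex_next_opp hx
          rw [h.opp_inl, qi]
          by_cases h1 : X.next (X.opp d) = a
          · rw [h.next_of_eq_left _ h1, qu, ← h1]; exact hd
          by_cases h2 : X.next (X.opp d) = b
          · rw [h.next_of_eq_right _ h2, qv, ← h2]; exact hd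
          rw [h.next_of_ne _ h1 h2, qi]; exact hd
        · rw [h.opp_u, h.next_v, qi, qu]; exact .refl _
        · rw [h.opp_v, h.next_u, qi, qv]; exact .refl _
      | refl => exact .refl _
      | symm _ _ _ ih => exact ih.symm
      | trans _ _ _ _ _ ih ih' => exact ih.trans ih'
    intro hd
    simpa [qi] using key hd
  · intro hd
    induction hd with
    | rel x y hxy =>
      obtain ⟨hx, rfl⟩ := hxy
      have hx' : Y.opp (ι x) ≠ ι x := by rwa [h.opp_inl, h.injective.ne_iff]
      have hs := sameVertex_next_opp hx'
      rw [h.opp_inl] at hs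
      by_cases h1 : X.next (X.opp x) = a
      · rw [h.next_of_eq_left _ h1] at hs
        rw [h1]; exact hs.trans h.sameVertex_u
      by_cases h2 : X.next (X.opp x) = b
      · rw [h.next_of_eq_right _ h2] at hs
        rw [h2]; exact hs.trans h.sameVertex_v
      rwa [h.next_of_ne _ h1 h2] at hs
    | refl => exact .refl _
    | symm _ _ _ ih => exact ih.symm
    | trans _ _ _ _ _ ih ih' => exact ih.trans ih'

theorem euler_preimage {F : Set X.Dart} (hF : FaceClosed F) : Y.euler (p ⁻¹' F) = X.euler F := by
  have hv0 : (verts (ι '' F)).ncard = (verts F).ncard :=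
    (ncard_image_comp fun a _ b _ => by
      rw [mk_eq_iff_sameVertex, mk_eq_iff_sameVertex, h.sameVertex_iff]).symm
  have he0 : (edges (ι '' F)).ncard = (edges F).ncard := by
    refine (ncard_image_comp fun a ha b hb => ?_).symm
    rw [edge_eq_iff, edge_eq_iff, h.opp_inl, h.injective.eq_iff, h.injective.eq_iff]
  -- The faces other than the subdivided one are not affected.
  have hf0 : (faces (ι '' (F \ {d | X.next.SameCycle a d}))).ncard =
      (faces (F \ {d | X.next.SameCycle a d})).ncard :=
    (ncard_image_comp fun c hc d _ => by
      rw [mk_eq_iff_sameCycle, mk_eq_iff_sameCycle, h.sameCycle_iff hc.2]).symm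
  rw [euler_eq, euler_eq]
  by_cases ha : a ∈ F
  · have hb : b ∈ F := (hF.mem_iff_of_sameCycle h.sameCycle).1 ha
    have hset : p ⁻¹' F = insert u (insert v (ι '' F)) := by
      ext x
      constructor
      · intro hx
        rcases h.cases x with ⟨d, rfl⟩ | rfl | rfl
        · exact Or.inr (Or.inr ⟨d, by simpa [h.p_inl] using hx, rfl⟩)
        · exact Or.inl rfl
        · exact Or.inr (Or.inl rfl)
      · rintro (rfl | rfl | ⟨d, hd, rfl⟩)
        · simpa [h.p_u] using ha
        · simpa [h.p_v] using ha
        · simpa [h.p_inl] using hd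
    have hv : verts (p ⁻¹' F) = verts (ι '' F) := by
      rw [hset]
      apply Set.Subset.antisymm
      · rintro _ ⟨y, (rfl | rfl | hy), rfl⟩
        · exact ⟨ι a, ⟨a, ha, rfl⟩, mk_eq_iff_sameVertex.2 h.sameVertex_u.symm⟩
        · exact ⟨ι b, ⟨b, hb, rfl⟩, mk_eq_iff_sameVertex.2 h.sameVertex_v.symm⟩
        · exact ⟨y, hy, rfl⟩
      · rintro _ ⟨y, hy, rfl⟩
        exact ⟨y, Or.inr (Or.inr hy), rfl⟩
    have he1 : s(u, Y.opp u) ∉ edges (ι '' F) := by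
      rw [mem_edges, h.opp_u]
      rintro (⟨d, -, hd⟩ | ⟨d, -, hd⟩)
      exacts [h.inl_ne_u _ hd, h.inl_ne_v _ hd]
    have he : edges (p ⁻¹' F) = insert s(u, Y.opp u) (edges (ι '' F)) := by
      rw [hset]
      have h1 : edges (insert u (insert v (ι '' F))) =
          insert s(u, Y.opp u) (insert s(v, Y.opp v) (edges (ι '' F))) := by
        rw [edges, Set.image_insert_eq, Set.image_insert_eq]; rfl
      rw [h1, edge_eq_iff.2 (Or.inr h.opp_u.symm : v = u ∨ v = Y.opp u), Set.insert_idem]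
    have hf1 : Quot.mk _ v ∉ faces (ι '' (F \ {d | X.next.SameCycle a d})) := by
      rintro ⟨_, ⟨d, hd, rfl⟩, hdv⟩
      have := h.sameCycle_of_sameCycle (mk_eq_iff_sameCycle.1 hdv)
      rw [h.p_inl, h.p_v] at this
      exact hd.2 this.symm
    have hf2 : Quot.mk _ u ∉
        insert (Quot.mk _ v) (faces (ι '' (F \ {d | X.next.SameCycle a d}))) := by
      rintro (huv | ⟨_, ⟨d, hd, rfl⟩, hdv⟩)
      · exact h.not_sameCycle_u_v (mk_eq_iff_sameCycle.1 huv).symm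
      have := h.sameCycle_of_sameCycle (mk_eq_iff_sameCycle.1 hdv)
      rw [h.p_inl, h.p_u] at this
      exact hd.2 this.symm
    have hf : faces (p ⁻¹' F) = insert (Quot.mk _ u)
        (insert (Quot.mk _ v) (faces (ι '' (F \ {d | X.next.SameCycle a d})))) := by
      apply Set.Subset.antisymm
      · rintro _ ⟨y, hy, rfl⟩
        by_cases hya : X.next.SameCycle a (p y)
        · rcases h.sameCycle_u_or_v hya with hc | hc
          · exact Or.inl (mk_eq_iff_sameCycle.2 hc.symm)
          · exact Or.inr (Or.inl (mk_eq_iff_sameCycle.2 hc.symm))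
        · rcases h.cases y with ⟨d, rfl⟩ | rfl | rfl
          · rw [h.p_inl] at hya
            exact Or.inr (Or.inr ⟨_, ⟨d, ⟨by simpa [h.p_inl] using hy, hya⟩, rfl⟩, rfl⟩)
          · rw [h.p_u] at hya; exact (hya (.refl _ _)).elim
          · rw [h.p_v] at hya; exact (hya (.refl _ _)).elim
      · rw [hset]
        rintro _ (rfl | rfl | ⟨_, ⟨d, hd, rfl⟩, rfl⟩)
        · exact ⟨u, Or.inl rfl, rfl⟩
        · exact ⟨v, Or.inr (Or.inl rfl), rfl⟩
        · exact ⟨_, Or.inr (Or.inr ⟨d, hd.1, rfl⟩), rfl⟩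
    have hf3 : Quot.mk _ a ∉ faces (F \ {d | X.next.SameCycle a d}) := by
      rintro ⟨d, hd, hda⟩
      exact hd.2 (mk_eq_iff_sameCycle.1 hda).symm
    have hf4 : faces F = insert (Quot.mk _ a) (faces (F \ {d | X.next.SameCycle a d})) := by
      apply Set.Subset.antisymm
      · rintro _ ⟨d, hd, rfl⟩
        by_cases had : X.next.SameCycle a d
        · exact Or.inl (mk_eq_iff_sameCycle.2 had.symm)
        · exact Or.inr ⟨d, ⟨hd, had⟩, rfl⟩
      · rintro _ (rfl | ⟨d, hd, rfl⟩)
        · exact ⟨a, ha, rfl⟩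
        · exact ⟨d, hd.1, rfl⟩
    rw [hv, he, hf, hf4, Set.ncard_insert_of_notMem he1, Set.ncard_insert_of_notMem hf2,
      Set.ncard_insert_of_notMem hf1, Set.ncard_insert_of_notMem hf3, hv0, he0, hf0]
    push_cast
    ring
  · have hset : p ⁻¹' F = ι '' F := by
      ext x
      constructor
      · intro hx
        rcases h.cases x with ⟨d, rfl⟩ | rfl | rfl
        · exact ⟨d, by simpa [h.p_inl] using hx, rfl⟩
        · exact (ha (by simpa [h.p_u] using hx)).elim
        · exact (ha (by simpa [h.p_v] using hx)).elim
      · rintro ⟨d, hd, rfl⟩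
        simpa [h.p_inl] using hd
    have hdiff : F \ {d | X.next.SameCycle a d} = F := by
      ext d
      exact ⟨fun hd => hd.1, fun hd => ⟨hd, fun had => ha ((hF.mem_iff_of_sameCycle had).2 hd)⟩⟩
    rw [hdiff] at hf0
    rw [hset, hv0, he0, hf0]

end IsFaceSplit

theorem isFaceSplit_splitFace (a b : X.Dart) (hab : a ≠ b) (h : X.next.SameCycle a b) :
    IsFaceSplit a b (Y := X.splitFace a b) (Sum.inl : X.Dart → X.Dart ⊕ Bool)
      (Sum.inr true : X.Dart ⊕ Bool) (Sum.inr false : X.Dart ⊕ Bool)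
      (fun d : X.Dart ⊕ Bool => Sum.elim id (fun _ => a) d) := by
  have hne : (Sum.inl a : X.Dart ⊕ Bool) ≠ Sum.inl b := by simpa using hab
  let n : Equiv.Perm (X.Dart ⊕ Bool) :=
    List.formPerm [Sum.inl a, Sum.inr true, Sum.inl b, Sum.inr false]
      * Equiv.sumCongr X.next (Equiv.refl Bool)
  refine
    { ne := hab
      sameCycle := h
      cases := ?_
      p_inl := fun _ => rfl
      p_u := rfl
      p_v := rfl
      inl_ne_u := fun _ => Sum.inl_ne_inr
      inl_ne_v := fun _ => Sum.inl_ne_inr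
      u_ne_v := fun h => Bool.noConfusion (Sum.inr_injective h)
      opp_inl := fun _ => rfl
      opp_u := rfl
      opp_v := rfl
      next_u := show n (Sum.inr true) = Sum.inl b from ?_
      next_v := show n (Sum.inr false) = Sum.inl a from ?_
      next_of_eq_left := fun d hd => show n (Sum.inl d) = Sum.inr true from ?_
      next_of_eq_right := fun d hd => show n (Sum.inl d) = Sum.inr false from ?_
      next_of_ne := fun d hd hd' => show n (Sum.inl d) = Sum.inl (X.next d) from ?_ }
  · rintro (d | (_ | _))
    exacts [Or.inl ⟨d, rfl⟩, Or.inr (Or.inr rfl), Or.inr (Or.inl rfl)]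
  · simp [n, Equiv.swap_apply_of_ne_of_ne, hne.symm]
  · simp [n]
  · simp [n, hd, Equiv.swap_apply_of_ne_of_ne, hne]
  · simp [n, hd, Equiv.swap_apply_of_ne_of_ne]
  · simp [n, hd, hd', Equiv.swap_apply_of_ne_of_ne]

end MarkedSurface

/-! ### Recolouring -/

namespace MarkedSurface

variable {X : MarkedSurface}

/-- Changing the colour of a region `A` does not affect the Euler characteristic of the black part
if attaching `A` to the rest of the black part does not. -/
theorem euler_eq_of_recolor {b b' A : Set X.Dart}
    (hA : ∀ x ∈ A, ∀ x' ∈ A, x ∈ b ↔ x' ∈ b) (hA' : ∀ x ∈ A, ∀ x' ∈ A, x ∈ b' ↔ x' ∈ b')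
    (hout : ∀ x, x ∉ A → (x ∈ b' ↔ x ∈ b))
    (h : ∀ x ∈ A, ¬ (x ∈ b' ↔ x ∈ b) → X.euler (b \ A ∪ A) = X.euler (b \ A)) :
    X.euler b' = X.euler b := by
  by_cases hx : ∃ x ∈ A, ¬ (x ∈ b' ↔ x ∈ b)
  · obtain ⟨x, hxA, hx⟩ := hx
    have h := h x hxA hx
    by_cases hxb : x ∈ b
    · have h1 : b \ A ∪ A = b := by
        ext y
        by_cases hy : y ∈ A
        · simp [hy, (hA x hxA y hy).1 hxb]
        · simp [hy]
      have h2 : b' = b \ A := by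
        ext y
        by_cases hy : y ∈ A
        · have := hA' x hxA y hy
          have hyb : y ∉ b' := by tauto
          simp [hy, hyb]
        · simp [hy, hout y hy]
      rw [h2, ← h, h1]
    · have h1 : b \ A ∪ A = b' := by
        ext y
        by_cases hy : y ∈ A
        · have := hA' x hxA y hy
          have hyb : y ∈ b' := by tauto
          simp [hy, hyb]
        · simp [hy, hout y hy]
      have h2 : b \ A = b := by
        ext y
        by_cases hy : y ∈ A
        · have hyb : y ∉ b := fun hyb => hxb ((hA x hxA y hy).2 hyb)
          simp [hyb]
        · simp [hy]
      rw [← h1, h, h2]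
  · push Not at hx
    congr 1
    ext y
    by_cases hy : y ∈ A
    exacts [hx y hy, hout y hy]

end MarkedSurface

namespace ColConfig

variable {X : MarkedSurface}

/-- The part of the checkerboard condition that the invariance of the Euler characteristic rests on:
colours change only across the curve, and they change along the whole of a component or nowhere on
it. -/
structure WellColored (g : ColConfig X) : Prop where
  isCurve : X.IsCurve g.curve
  faceClosed : FaceClosed g.black
  off_curve : ∀ d, d ∉ g.curve → (X.opp d ∈ g.black ↔ d ∈ g.black)
  on_comp : ∀ d d', X.SameComp g.curve d d' →
    ((X.opp d ∈ g.black ↔ d ∈ g.black) ↔ (X.opp d' ∈ g.black ↔ d' ∈ g.black))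

theorem Valid.wellColored {g : ColConfig X} (hg : g.Valid) : g.WellColored := by
  have hoff : ∀ d, d ∉ g.curve → (X.opp d ∈ g.black ↔ d ∈ g.black) := by
    intro d hd
    by_cases hdd : X.opp d = d
    · rw [hdd]
    · have := hg.black_opp d hdd
      have h1 : ¬ X.OnArc g.curve d := fun h => hd h.1
      have h2 : ¬ X.OnCircle g.curve d := fun h => hd h.1
      tauto
  refine ⟨hg.toConfig.isCurve, hg.black_next, hoff, fun d d' h => ?_⟩
  by_cases hd : d ∈ g.curve
  · have hd' := h.mem_iff.1 hd
    have h1 := hg.black_opp d (hg.toConfig.isCurve.opp_ne d hd)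
    have h2 := hg.black_opp d' (hg.toConfig.isCurve.opp_ne d' hd')
    rw [OnArc.congr h, OnCircle.congr h, hg.toConfig.label_eq d d' h, ← h2] at h1
    tauto
  · have hd' := fun h' => hd (h.mem_iff.2 h')
    exact iff_of_true (hoff d hd) (hoff d' hd')

theorem euler_of_push {g g' : ColConfig X} {s : X.Dart} {k n : ℕ} {P : Set X.Dart}
    (hg : g.WellColored) (h : g.Push g' s k n P) : X.euler g'.black = X.euler g.black := by
  obtain ⟨h, hblack, hblack'⟩ := h
  have hk := h.k_lt
  have hk0 := h.k_pos
  have hP : IsPolygon s n P :=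
    ⟨h.face, h.k_pos.trans h.k_lt, h.closed, h.embedded, h.opp_notMem⟩
  have hsP : s ∈ P := hP.iterate_mem (i := 0) hP.pos
  have hcol : ∀ x ∈ P, (x ∈ g.black ↔ s ∈ g.black) := by
    intro x hx
    rw [hP.face] at hx
    obtain ⟨i, -, rfl⟩ := hx
    exact hg.faceClosed.iterate_mem_iff i s
  have hnext : ∀ i, X.next (X.next^[i] s) = X.next^[i + 1] s := fun i =>
    (Function.iterate_succ_apply' X.next i s).symm
  have hstep : ∀ i < n, X.SameVertex (X.opp (X.next^[i] s)) (X.next^[i + 1] s) := fun i hi => by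
    rw [← hnext]
    exact sameVertex_opp_next (hP.opp_ne (hP.iterate_mem hi))
  have hcomp : ∀ i < k, X.SameComp g.curve s (X.next^[i] s) := by
    intro i
    induction i with
    | zero => exact fun _ => EqvGen.refl _
    | succ i ih =>
      intro hi
      have h1 := h.on_curve i (by omega)
      have h2 := hg.isCurve.opp_mem _ h1
      exact ((ih (by omega)).trans (.of_opp h1 h2)).trans
        (.of_sameVertex (hstep i (by omega)) h2 (h.on_curve _ hi))
  refine euler_eq_of_recolor (A := P) (fun x hx x' hx' => (hcol x hx).trans (hcol x' hx').symm)
    (fun x hx x' hx' => (hblack x hx).trans (hblack x' hx').symm) hblack' ?_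
  intro x hx hne
  rw [hblack x hx, hcol x hx] at hne
  have hF : FaceClosed (g.black \ P) := hg.faceClosed.diff hP.faceClosed
  have hdisj : Disjoint (g.black \ P) P := Set.disjoint_sdiff_left
  -- The colours across the sides of the polygon.
  have hopp1 : ∀ i < k, (X.opp (X.next^[i] s) ∈ g.black ↔ X.opp s ∈ g.black) := by
    intro i hi
    have h1 := hg.on_comp _ _ (hcomp i hi)
    have h2 := hg.faceClosed.iterate_mem_iff i s
    tauto
  have hopp2 : ∀ i, k ≤ i → i < n → (X.opp (X.next^[i] s) ∈ g.black ↔ s ∈ g.black) := by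
    intro i hi hi'
    rw [hg.off_curve _ (h.off_curve i hi hi'), hg.faceClosed.iterate_mem_iff]
  have hoppP : ∀ i < n, X.opp (X.next^[i] s) ∉ P := fun i hi => hP.opp_notMem _ (hP.iterate_mem hi)
  have hv1 : ∀ i < n, X.opp (X.next^[i] s) ∈ g.black \ P →
      Quot.mk X.SameVertex (X.next^[i] s) ∈ verts (g.black \ P) := fun i hi =>
    hF.mk_mem_verts_of_opp_mem (hP.opp_ne (hP.iterate_mem hi))
  have hv2 : ∀ i < n, X.opp (X.next^[i] s) ∈ g.black \ P →
      Quot.mk X.SameVertex (X.next^[i + 1] s) ∈ verts (g.black \ P) := fun i hi hib =>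
    mk_mem_verts.2 ⟨_, hib, hstep i hi⟩
  by_cases hz : X.opp s ∈ g.black
  · -- The polygon is attached along the pushed path, which has `k` edges and `k + 1` vertices.
    have hsb : s ∉ g.black := by tauto
    rw [hP.euler_union hF hdisj (Finset.range (k + 1)) (Finset.range k)]
    · simp only [Finset.card_range]; push_cast; ring
    · intro i
      rw [Finset.mem_range]
      constructor
      · intro hi
        refine ⟨by omega, ?_⟩
        rcases Nat.lt_or_eq_of_le (Nat.lt_succ_iff.1 hi) with hlt | heq
        · exact hv1 i (by omega) ⟨(hopp1 i hlt).2 hz, hoppP i (by omega)⟩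
        · obtain ⟨j, rfl⟩ : ∃ j, i = j + 1 := ⟨i - 1, by omega⟩
          exact hv2 j (by omega) ⟨(hopp1 j (by omega)).2 hz, hoppP j (by omega)⟩
      · rintro ⟨hi, hiv⟩
        by_contra! hki
        obtain ⟨f, hf, hfi⟩ := mk_mem_verts.1 hiv
        refine hsb ((hg.faceClosed.iterate_mem_iff i s).1
          ((hg.faceClosed.mem_iff_of_sameVertex hfi.symm fun y hy => ?_).2 hf.1))
        exact hg.off_curve y (h.off_vertex i (by omega) hi y hy)
    · intro i
      rw [Finset.mem_range]
      constructor
      · exact fun hi => ⟨by omega, (hopp1 i hi).2 hz, hoppP i (by omega)⟩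
      · rintro ⟨hi, hib⟩
        by_contra! hki
        exact hsb ((hopp2 i hki hi).1 hib.1)
  · -- The polygon is attached along the complementary path.
    have hsb : s ∈ g.black := by tauto
    rw [hP.euler_union hF hdisj (Finset.range n \ Finset.Ioo 0 k) (Finset.Ico k n)]
    · have hsub : Finset.Ioo 0 k ⊆ Finset.range n := fun i hi => by
        rw [Finset.mem_Ioo] at hi
        rw [Finset.mem_range]
        omega
      rw [Finset.card_sdiff_of_subset hsub, Finset.card_range, Nat.card_Ioo, Nat.card_Ico]
      omega
    · intro i
      rw [Finset.mem_sdiff, Finset.mem_range, Finset.mem_Ioo]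
      refine and_congr_right fun hi => ?_
      constructor
      · intro hik
        rcases Nat.eq_zero_or_pos i with rfl | hi0
        · have := hv2 (n - 1) (by omega) ⟨(hopp2 (n - 1) (by omega) (by omega)).2 hsb,
            hoppP _ (by omega)⟩
          rwa [Nat.sub_add_cancel (by omega), h.closed] at this
        · exact hv1 i hi ⟨(hopp2 i (by omega) hi).2 hsb, hoppP i hi⟩
      · rintro hiv ⟨hi0, hik⟩
        obtain ⟨f, hf, hfi⟩ := mk_mem_verts.1 hiv
        refine Set.disjoint_left.1 hdisj
          ((hF.mem_iff_of_sameVertex hfi.symm fun y hy => ?_).2 hf) (hP.iterate_mem hi)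
        obtain ⟨j, rfl⟩ : ∃ j, i = j + 1 := ⟨i - 1, by omega⟩
        have hjP := hP.iterate_mem (i := j) (by omega)
        -- The darts of the curve at an inner vertex of the pushed path are those of the path.
        by_cases hyc : y ∈ g.curve
        · have hcj := hg.isCurve.opp_mem _ (h.on_curve j (by omega))
          have hne : X.next^[j + 1] s ≠ X.opp (X.next^[j] s) := fun heq =>
            hoppP j (by omega) (heq ▸ hP.iterate_mem hi)
          rcases hg.isCurve.eq_or_eq_of_sameVertex (h.on_curve (j + 1) hik) hcj hyc hne
            (hstep j (by omega)).symm hy with rfl | rfl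
          · have h1 := hopp1 (j + 1) hik
            exact iff_of_false (fun hb => hz (h1.1 hb.1)) fun hb => hb.2 (hP.iterate_mem hi)
          · have h1 := hopp1 j (by omega)
            rw [X.opp_opp]
            exact iff_of_false (fun hb => hb.2 hjP) fun hb => hz (h1.1 hb.1)
        · have hyP : y ∉ P := fun hyP => by
            rw [hP.face] at hyP
            obtain ⟨l, hl, rfl⟩ := hyP
            cases h.embedded _ hi _ hl hy
            exact hyc (h.on_curve _ hik)
          have hyP' : X.opp y ∉ P := fun hyP => by
            rw [hP.face] at hyP
            obtain ⟨l, hl, hly⟩ := hyP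
            have hyl : y = X.opp (X.next^[l] s) := by rw [← hly, X.opp_opp]
            have hyv : X.SameVertex (X.next^[j + 1] s) (X.next^[l + 1] s) :=
              hy.trans (hyl ▸ hstep l hl)
            rcases Nat.lt_or_eq_of_le (Nat.succ_le_of_lt hl) with hlt | heq
            · have := h.embedded _ hi _ hlt hyv
              refine hyc (hyl ▸ hg.isCurve.opp_mem _ (h.on_curve l (by omega)))
            · rw [show l + 1 = n from heq, h.closed] at hyv
              have := h.embedded _ hi 0 (by omega) hyv
              omega
          rw [Set.mem_sdiff, Set.mem_sdiff, hg.off_curve y hyc]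
          simp [hyP, hyP']
    · intro i
      rw [Finset.mem_Ico]
      constructor
      · exact fun hi => ⟨hi.2, (hopp2 i hi.1 hi.2).2 hsb, hoppP i hi.2⟩
      · rintro ⟨hi, hib⟩
        refine ⟨?_, hi⟩
        by_contra! hki
        exact hz ((hopp1 i hki).1 hib.1)

end ColConfig

namespace ColConfig

variable {X : MarkedSurface}

/-! ### Merging circles -/

section Merge

variable {g g' : ColConfig X} {d e : X.Dart} {A : Set X.Dart}

theorem sameComp_mem_of_merge {x y : X.Dart} (hx : x ∈ X.comp g.curve d ∪ X.comp g.curve e)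
    (hxy : X.SameComp g.curve x y) : y ∈ X.comp g.curve d ∪ X.comp g.curve e :=
  hx.imp (fun hx => SameComp.trans hx hxy) (fun hx => SameComp.trans hx hxy)

variable (hg : g.WellColored) (h : g.toConfig.Merge g'.toConfig d e A)

section

include h

theorem mem_curve_of_merge {x : X.Dart} (hx : x ∈ X.comp g.curve d ∪ X.comp g.curve e) :
    x ∈ g.curve := by
  rcases hx with hx | hx
  · exact (SameComp.mem_iff hx).1 h.cobound.onCircle_left.1
  · exact (SameComp.mem_iff hx).1 h.cobound.onCircle_right.1

/-- The boundary circles of the annulus have the annulus on exactly one side. -/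
theorem mem_annulus_iff {x : X.Dart} (hx : x ∈ X.comp g.curve d ∪ X.comp g.curve e) :
    x ∈ A ↔ X.opp x ∉ A := by
  have hs := h.cobound.annulus.1
  constructor
  · exact fun hxA => (hs.frontier x hxA).2 hx
  · exact fun hxA => (hs.one_side x hx).resolve_right hxA

theorem faceClosed_annulus : FaceClosed A := faceClosed_of_mapsTo h.cobound.annulus.1.next_mem

end

include hg h

theorem opp_mem_of_merge {x : X.Dart} (hx : x ∈ X.comp g.curve d ∪ X.comp g.curve e) :
    X.opp x ∈ X.comp g.curve d ∪ X.comp g.curve e := by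
  have hxc := mem_curve_of_merge h hx
  exact sameComp_mem_of_merge hx (.of_opp hxc (hg.isCurve.opp_mem _ hxc))

theorem opp_mem_annulus_iff {x : X.Dart} (hx : x ∉ X.comp g.curve d ∪ X.comp g.curve e) :
    X.opp x ∈ A ↔ x ∈ A := by
  have hs := h.cobound.annulus.1
  constructor
  · intro hxA
    by_contra hxA'
    have hf := (hs.frontier _ hxA).1 (by rwa [X.opp_opp])
    have := opp_mem_of_merge hg h hf
    rw [X.opp_opp] at this
    exact hx this
  · intro hxA
    by_contra hxA'
    exact hx ((hs.frontier x hxA).1 hxA')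

/-- No part of the curve separates the annulus, so that it has one colour. -/
theorem mem_black_iff_of_mem_annulus {x y : X.Dart} (hx : x ∈ A) (hy : y ∈ A) :
    x ∈ g.black ↔ y ∈ g.black := by
  have hs := h.cobound.annulus.1
  have hxy := hs.connected x hx y hy
  clear hx hy
  induction hxy with
  | rel x y hxy =>
    obtain ⟨hx, hy, rfl | rfl⟩ := hxy
    · exact (hg.faceClosed x).symm
    · refine (hg.off_curve x fun hxc => ?_).symm
      exact (mem_annulus_iff h (h.empty x hx hxc)).1 hx hy
  | refl => rfl
  | symm _ _ _ ih => exact ih.symm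
  | trans _ _ _ _ _ ih ih' => exact ih.trans ih'

/-- The outer sides of a boundary circle of the annulus have one colour. -/
theorem mem_black_iff_of_notMem_annulus {x y : X.Dart}
    (hx : x ∈ X.comp g.curve d ∪ X.comp g.curve e) (hxy : X.SameComp g.curve x y)
    (hxA : x ∉ A) (hyA : y ∉ A) : x ∈ g.black ↔ y ∈ g.black := by
  have hy := sameComp_mem_of_merge hx hxy
  have h1 := mem_black_iff_of_mem_annulus hg h
    ((not_iff_comm.1 (mem_annulus_iff h hx).symm).1 hxA)
    ((not_iff_comm.1 (mem_annulus_iff h hy).symm).1 hyA)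
  have h2 := hg.on_comp x y hxy
  tauto

/-- Attaching the annulus to the black regions outside of it: the intersection consists of
boundary circles of the annulus and has Euler characteristic zero. -/
theorem euler_diff_union_annulus : X.euler (g.black \ A ∪ A) = X.euler (g.black \ A) := by
  have hA := faceClosed_annulus h
  have hF : FaceClosed (g.black \ A) := hg.faceClosed.diff hA
  let M : Set X.Dart := {m | m ∈ X.comp g.curve d ∪ X.comp g.curve e ∧
    (m ∈ g.black \ A ∨ X.opp m ∈ g.black \ A)}
  have hMopp : ∀ m ∈ M, (m ∈ g.black \ A ∧ X.opp m ∈ A) ∨ (X.opp m ∈ g.black \ A ∧ m ∈ A) := by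
    rintro m ⟨hm, hmF | hmF⟩
    · exact Or.inl ⟨hmF, not_not.1 fun hA' => hmF.2 ((mem_annulus_iff h hm).2 hA')⟩
    · exact Or.inr ⟨hmF, (mem_annulus_iff h hm).2 hmF.2⟩
  have hMcirc : ∀ m ∈ M, X.OnCircle g.curve m := by
    rintro m ⟨hm | hm, -⟩
    · exact (OnCircle.congr hm).1 h.cobound.onCircle_left
    · exact (OnCircle.congr hm).1 h.cobound.onCircle_right
  have hMcomp : ∀ m ∈ M, ∀ m', X.SameComp g.curve m m' → m' ∈ M := by
    intro m hm m' hmm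
    have hmc := mem_curve_of_merge h hm.1
    have hmc' := (SameComp.mem_iff hmm).1 hmc
    have hm' := sameComp_mem_of_merge hm.1 hmm
    have ho : X.SameComp g.curve (X.opp m) m :=
      (SameComp.of_opp hmc (hg.isCurve.opp_mem _ hmc)).symm
    have ho' := SameComp.of_opp hmc' (hg.isCurve.opp_mem _ hmc')
    refine ⟨hm', ?_⟩
    by_cases hm'A : m' ∈ A
    · have hm'o := (mem_annulus_iff h hm').1 hm'A
      refine Or.inr ⟨?_, hm'o⟩
      rcases hMopp m hm with ⟨hmF, -⟩ | ⟨hmF, -⟩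
      · exact (mem_black_iff_of_notMem_annulus hg h hm.1 (hmm.trans ho') hmF.2 hm'o).1 hmF.1
      · exact (mem_black_iff_of_notMem_annulus hg h (opp_mem_of_merge hg h hm.1)
          ((ho.trans hmm).trans ho') hmF.2 hm'o).1 hmF.1
    · refine Or.inl ⟨?_, hm'A⟩
      rcases hMopp m hm with ⟨hmF, -⟩ | ⟨hmF, -⟩
      · exact (mem_black_iff_of_notMem_annulus hg h hm.1 hmm hmF.2 hm'A).1 hmF.1
      · exact (mem_black_iff_of_notMem_annulus hg h (opp_mem_of_merge hg h hm.1)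
          (ho.trans hmm) hmF.2 hm'A).1 hmF.1
  have hne : ∀ m ∈ M, X.opp m ≠ m := fun m hm =>
    hg.isCurve.opp_ne m (mem_curve_of_merge h hm.1)
  have hV : verts (g.black \ A) ∩ verts A = verts M := by
    apply Set.Subset.antisymm
    · rintro _ ⟨⟨b, hb, rfl⟩, a, ha, hab⟩
      have hab := mk_eq_iff_sameVertex.1 hab
      obtain ⟨m, hm, hmA⟩ := hA.exists_frontier_of_sameVertex ha hb.2 hab
      have hmB : m ∈ X.comp g.curve d ∪ X.comp g.curve e := by
        by_contra hmB
        exact hmA (opp_mem_annulus_iff hg h hmB)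
      refine mk_mem_verts.2 ⟨m, ?_, hm.symm.trans hab⟩
      -- Otherwise the black part outside of the annulus would have no frontier at this vertex.
      by_contra hmM
      have hmc := mem_curve_of_merge h hmB
      refine ((hF.mem_iff_of_sameVertex hab fun x hx => ?_).2 hb).2 ha
      by_cases hxc : x ∈ g.curve
      · have hmx : X.SameComp g.curve m x := .of_sameVertex (hm.symm.trans hx) hmc hxc
        have hxM : x ∉ M := fun hxM => hmM (hMcomp x hxM m hmx.symm)
        have hxB := sameComp_mem_of_merge hmB hmx
        exact iff_of_false (fun hx => hxM ⟨hxB, Or.inr hx⟩) fun hx => hxM ⟨hxB, Or.inl hx⟩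
      · have hxB : x ∉ X.comp g.curve d ∪ X.comp g.curve e := fun hxB =>
          hxc (mem_curve_of_merge h hxB)
        rw [Set.mem_sdiff, Set.mem_sdiff, hg.off_curve x hxc, opp_mem_annulus_iff hg h hxB]
    · rintro _ ⟨m, hm, rfl⟩
      rcases hMopp m hm with ⟨hm1, hm2⟩ | ⟨hm1, hm2⟩
      · exact ⟨⟨m, hm1, rfl⟩, hA.mk_mem_verts_of_opp_mem (hne m hm) hm2⟩
      · exact ⟨hF.mk_mem_verts_of_opp_mem (hne m hm) hm1, ⟨m, hm2, rfl⟩⟩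
  have hE : edges (g.black \ A) ∩ edges A = edges M := by
    apply Set.Subset.antisymm
    · rintro _ ⟨⟨b, hb, rfl⟩, hbA⟩
      have hbA := (mem_edges.1 hbA).resolve_left hb.2
      refine ⟨b, ⟨?_, Or.inl hb⟩, rfl⟩
      by_contra hbB
      exact hb.2 ((opp_mem_annulus_iff hg h hbB).1 hbA)
    · rintro _ ⟨m, hm, rfl⟩
      rcases hMopp m hm with ⟨hm1, hm2⟩ | ⟨hm1, hm2⟩
      · exact ⟨mem_edges.2 (Or.inl hm1), mem_edges.2 (Or.inr hm2)⟩
      · exact ⟨mem_edges.2 (Or.inr hm1), mem_edges.2 (Or.inl hm2)⟩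
  rw [euler_union hF Set.disjoint_sdiff_left, hV, hE,
    hg.isCurve.ncard_verts_eq_ncard_edges hMcirc hMcomp, h.cobound.annulus.2]
  ring

/-- Removing a circle from a curve leaves a curve. -/
theorem isCurve_of_merge : X.IsCurve g'.curve := by
  have hC := hg.isCurve
  have he := h.cobound.onCircle_right
  have hLc : ∀ x ∈ X.comp g.curve e, X.OnCircle g.curve x := fun x hx => (OnCircle.congr hx).1 he
  have hsub : g'.curve ⊆ g.curve := by rw [h.curve_eq]; exact Set.sdiff_subset
  -- At a vertex, the removed circle contains all of the curve or nothing.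
  have hdeg : ∀ v, (∃ x ∈ X.comp g.curve e, X.SameVertex v x) → X.degree g'.curve v = 0 := by
    rintro v ⟨x, hx, hvx⟩
    rw [degree, Set.ncard_eq_zero, Set.eq_empty_iff_forall_notMem]
    rintro y ⟨hvy, hy⟩
    rw [h.curve_eq] at hy
    exact hy.2 (SameComp.trans hx (.of_sameVertex (hvx.symm.trans hvy) (hLc x hx).1 hy.1))
  have hdeg' : ∀ v, (¬ ∃ x ∈ X.comp g.curve e, X.SameVertex v x) →
      X.degree g'.curve v = X.degree g.curve v := by
    intro v hv
    unfold degree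
    congr 1
    ext y
    refine and_congr_right fun hvy => ⟨fun hy => hsub hy, fun hy => ?_⟩
    rw [h.curve_eq]
    exact ⟨hy, fun hye => hv ⟨y, hye, hvy⟩⟩
  refine ⟨fun x hx => ?_, fun x hx => hC.opp_ne x (hsub hx), fun v hv => ?_, fun b hb => ?_,
    fun b hb hbm => ?_⟩
  · rw [h.curve_eq] at hx ⊢
    have hxo := hC.opp_mem x hx.1
    exact ⟨hxo, fun hxe => hx.2 (SameComp.trans hxe (SameComp.of_opp hx.1 hxo).symm)⟩
  · by_cases hx : ∃ x ∈ X.comp g.curve e, X.SameVertex v x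
    · exact Or.inl (hdeg v hx)
    · rw [hdeg' v hx]; exact hC.interior v hv
  · rw [hdeg' b, hC.marked b hb]
    rintro ⟨x, hx, hbx⟩
    exact (hLc x hx).2 ⟨(hLc x hx).1, b, hb, x, (hLc x hx).1, EqvGen.refl _, hbx.symm⟩
  · by_cases hx : ∃ x ∈ X.comp g.curve e, X.SameVertex b x
    · exact hdeg b hx
    · rw [hdeg' b hx]; exact hC.unmarked b hb hbm

omit h in
theorem euler_of_merge (h : g.Merge g' d e A) : X.euler g'.black = X.euler g.black :=
  euler_eq_of_recolor (A := A)
    (fun _ hx _ hy => mem_black_iff_of_mem_annulus hg h.toConfig hx hy)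
    (fun x hx y hy => (h.black_mem x hx).trans (h.black_mem y hy).symm) h.black_notMem
    fun _ _ _ => euler_diff_union_annulus hg h.toConfig

omit h in
theorem WellColored.merge (h : g.Merge g' d e A) : g'.WellColored := by
  have hm := h.toConfig
  have hA := faceClosed_annulus hm
  have heB : e ∈ X.comp g.curve d ∪ X.comp g.curve e := Or.inr (EqvGen.refl _)
  have heo : X.opp e ∉ A := (mem_annulus_iff hm heB).1 hm.mem
  have hec := mem_curve_of_merge hm heB
  have hee : X.SameComp g.curve e (X.opp e) := .of_opp hec (hg.isCurve.opp_mem _ hec)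
  have hsub : g'.curve ⊆ g.curve := by rw [hm.curve_eq]; exact Set.sdiff_subset
  -- Away from the boundary of the annulus, new and old colours change together.
  have hoff : ∀ x, x ∉ X.comp g.curve d ∪ X.comp g.curve e →
      ((X.opp x ∈ g.black ↔ x ∈ g.black) → (X.opp x ∈ g'.black ↔ x ∈ g'.black)) ∧
      (x ∈ g.curve → ((X.opp x ∈ g'.black ↔ x ∈ g'.black) ↔
        (X.opp x ∈ g.black ↔ x ∈ g.black))) := by
    intro x hx
    have hxA := opp_mem_annulus_iff hg hm hx
    by_cases hxA' : x ∈ A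
    · refine ⟨fun _ => (h.black_mem _ (hxA.2 hxA')).trans (h.black_mem _ hxA').symm, fun hxc => ?_⟩
      exact (hx (hm.empty x hxA' hxc)).elim
    · rw [h.black_notMem _ hxA', h.black_notMem _ fun hxo => hxA' (hxA.1 hxo)]
      exact ⟨id, fun _ => Iff.rfl⟩
  refine ⟨isCurve_of_merge hg hm, fun x => ?_, fun x hx => ?_, fun x y hxy => ?_⟩
  · by_cases hx : x ∈ A
    · rw [h.black_mem x hx, h.black_mem _ ((hA x).2 hx)]
    · rw [h.black_notMem x hx, h.black_notMem _ fun hx' => hx ((hA x).1 hx'), hg.faceClosed]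
  · by_cases hxe : x ∈ X.comp g.curve e
    · have hxB : x ∈ X.comp g.curve d ∪ X.comp g.curve e := Or.inr hxe
      have hxA := mem_annulus_iff hm hxB
      have hxc := mem_curve_of_merge hm hxB
      have hxo : X.SameComp g.curve x (X.opp x) := .of_opp hxc (hg.isCurve.opp_mem _ hxc)
      by_cases hxA' : x ∈ A
      · rw [h.black_mem x hxA', h.black_notMem _ (hxA.1 hxA')]
        exact mem_black_iff_of_notMem_annulus hg hm (opp_mem_of_merge hg hm hxB)
          ((hxo.symm.trans (SameComp.symm hxe)).trans hee) (hxA.1 hxA') heo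
      · rw [h.black_mem (X.opp x) (not_not.1 fun hA' => hxA' (hxA.2 hA')),
          h.black_notMem x hxA']
        exact (mem_black_iff_of_notMem_annulus hg hm hxB
          ((SameComp.symm hxe).trans hee) hxA' heo).symm
    · have hxc : x ∉ g.curve := fun hxc => hx (by rw [hm.curve_eq]; exact ⟨hxc, hxe⟩)
      exact (hoff x fun hxB => hxc (mem_curve_of_merge hm hxB)).1 (hg.off_curve x hxc)
  · by_cases hxc' : x ∈ g'.curve
    · have hyc' := hxy.mem_iff.1 hxc'
      have hxy' := hxy.mono hsub
      by_cases hxB : x ∈ X.comp g.curve d ∪ X.comp g.curve e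
      · have hyB := sameComp_mem_of_merge hxB hxy'
        have hxA := mem_annulus_iff hm hxB
        have hyA := mem_annulus_iff hm hyB
        have hxc := hsub hxc'
        have hyc := hsub hyc'
        have hxo : X.SameComp g.curve (X.opp x) x :=
          (SameComp.of_opp hxc (hg.isCurve.opp_mem _ hxc)).symm
        have hyo : X.SameComp g.curve y (X.opp y) := .of_opp hyc (hg.isCurve.opp_mem _ hyc)
        have houter : ∀ {u v}, u ∈ X.comp g.curve d ∪ X.comp g.curve e →
            X.SameComp g.curve u v → u ∉ A → v ∉ A → (u ∈ g'.black ↔ v ∈ g'.black) := by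
          intro u v hu huv huA hvA
          rw [h.black_notMem u huA, h.black_notMem v hvA]
          exact mem_black_iff_of_notMem_annulus hg hm hu huv huA hvA
        have hinner : ∀ {u v}, u ∈ A → v ∈ A → (u ∈ g'.black ↔ v ∈ g'.black) := fun hu hv =>
          (h.black_mem _ hu).trans (h.black_mem _ hv).symm
        have hxoB := opp_mem_of_merge hg hm hxB
        by_cases hxA' : x ∈ A <;> by_cases hyA' : y ∈ A
        · rw [hinner hxA' hyA', houter hxoB ((hxo.trans hxy').trans hyo) (hxA.1 hxA')
            (hyA.1 hyA')]
        · rw [hinner hxA' (not_not.1 fun hA' => hyA' (hyA.2 hA')),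
            houter hxoB (hxo.trans hxy') (hxA.1 hxA') hyA']
          exact iff_comm
        · rw [hinner (not_not.1 fun hA' => hxA' (hxA.2 hA')) hyA',
            houter hxB (hxy'.trans hyo) hxA' (hyA.1 hyA')]
          exact iff_comm
        · rw [hinner (not_not.1 fun hA' => hxA' (hxA.2 hA'))
            (not_not.1 fun hA' => hyA' (hyA.2 hA')), houter hxB hxy' hxA' hyA']
      · have hyB : y ∉ X.comp g.curve d ∪ X.comp g.curve e := fun hyB =>
          hxB (sameComp_mem_of_merge hyB hxy'.symm)
        rw [(hoff x hxB).2 (hsub hxc'), (hoff y hyB).2 (hsub hyc')]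
        exact hg.on_comp x y hxy'
    · -- Off the curve a component is a single dart.
      have key : ∀ {u v}, X.SameComp g'.curve u v → u ∉ g'.curve → u = v := by
        intro u v huv
        induction huv with
        | rel u v huv => exact fun hu => (hu huv.1).elim
        | refl => exact fun _ => rfl
        | symm u v huv ih =>
          exact fun hv => (ih fun hu => hv ((SameComp.mem_iff huv).1 hu)).symm
        | trans u v w huv _ ih ih' =>
          exact fun hu => (ih hu).trans (ih' fun hv => hu ((SameComp.mem_iff huv).2 hv))
      rw [key hxy hxc']

end Merge

/-! ### The Euler characteristic of a coloured glyph -/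

/-- Isotopy and erasure of circles do not change the Euler characteristic of the black part. The
statement on face-closedness is what makes the induction pass through the subdivisions. -/
theorem euler_eq_of_colGlyphRel {X : MarkedSurface} {g g' : ColConfig X}
    (h : ColGlyphRel X g g') :
    (FaceClosed g.black ↔ FaceClosed g'.black) ∧
      (FaceClosed g.black → X.euler g.black = X.euler g'.black) := by
  induction h with
  | refl g => exact ⟨Iff.rfl, fun _ => rfl⟩
  | symm _ ih => exact ⟨ih.1.symm, fun h => (ih.2 (ih.1.2 h)).symm⟩
  | trans _ _ ih ih' =>
    exact ⟨ih.1.trans ih'.1, fun h => (ih.2 h).trans (ih'.2 (ih.1.1 h))⟩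
  | push s k n P hg hg' h =>
    exact ⟨iff_of_true hg.black_next hg'.black_next, fun _ =>
      (euler_of_push hg.wellColored h).symm⟩
  | erase d _ _ h => rw [h.black_eq]; exact ⟨Iff.rfl, fun _ => rfl⟩
  | @splitEdge X g g' e he _ ih =>
    have hs := isEdgeSplit_splitEdge e he
    have h1 := ih.1
    have h2 := ih.2
    have hc : ∀ g : ColConfig X, FaceClosed (g.splitEdge e he).black ↔ FaceClosed g.black :=
      fun g => hs.faceClosed_iff
    have hE : ∀ g : ColConfig X,
        (X.splitEdge e he).euler (g.splitEdge e he).black = X.euler g.black :=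
      fun g => hs.euler_preimage g.black
    rw [hc, hc] at h1
    rw [hc, hE, hE] at h2
    exact ⟨h1, h2⟩
  | @splitBoundary X g g' e he _ ih =>
    have hs := isBoundarySplit_splitBoundary e he
    have h1 := ih.1
    have h2 := ih.2
    have hc : ∀ g : ColConfig X, FaceClosed (g.splitBoundary e).black ↔ FaceClosed g.black :=
      fun g => hs.faceClosed_iff
    have hE : ∀ g : ColConfig X,
        (X.splitBoundary e).euler (g.splitBoundary e).black = X.euler g.black :=
      fun g => hs.euler_preimage g.black
    rw [hc, hc] at h1
    rw [hc, hE, hE] at h2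
    exact ⟨h1, h2⟩
  | @splitFace X g g' a b hab h _ ih =>
    have hs := isFaceSplit_splitFace a b hab h
    have hc : ∀ g : ColConfig X, FaceClosed (g.splitFace a b).black ↔ FaceClosed g.black :=
      fun g => hs.faceClosed_iff
    have hE : ∀ g : ColConfig X, FaceClosed g.black →
        (X.splitFace a b).euler (g.splitFace a b).black = X.euler g.black :=
      fun g hg => hs.euler_preimage hg
    have h1 : FaceClosed g.black ↔ FaceClosed g'.black := by rw [← hc, ← hc]; exact ih.1
    refine ⟨h1, fun hg => ?_⟩
    rw [← hE g hg, ← hE g' (h1.1 hg)]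
    exact ih.2 ((hc g).2 hg)

end ColConfig

/-- The Euler characteristic of the black part of a coloured glyph. -/
noncomputable def ColoredGlyph.euler {X : MarkedSurface} (bc : ColoredGlyph X) : ℤ :=
  Quot.lift (fun g : {g : ColConfig X // g.Valid} => X.euler g.1.black)
    (fun g _ h => (ColConfig.euler_eq_of_colGlyphRel h).2 g.2.black_next) bc

open ColConfig in
theorem ColConfig.WellColored.euler_eq_of_reflTransGen {X : MarkedSurface} {g g' : ColConfig X}
    (hg : g.WellColored) (h : ReflTransGen (fun h h' => ∃ d e A, h.Merge h' d e A) g g') :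
    X.euler g'.black = X.euler g.black := by
  have key : g'.WellColored ∧ X.euler g'.black = X.euler g.black := by
    induction h with
    | refl => exact ⟨hg, rfl⟩
    | tail _ h ih =>
      obtain ⟨d, e, A, h⟩ := h
      exact ⟨ih.1.merge h, (euler_of_merge ih.1 h).trans ih.2⟩
  exact key.2

namespace MarkedSurface

variable {X : MarkedSurface}

/-! ### Turning around a vertex -/

theorem eq_of_degree_le_one {C : Set X.Dart} {v a b : X.Dart} (h : X.degree C v ≤ 1)
    (ha : a ∈ C) (hb : b ∈ C) (hva : X.SameVertex v a) (hvb : X.SameVertex v b) : a = b :=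
  (Set.ncard_le_one (Set.toFinite _)).1 h a ⟨hva, ha⟩ b ⟨hvb, hb⟩

theorem exists_of_degree_eq_one {C : Set X.Dart} {v : X.Dart} (h : X.degree C v = 1) :
    ∃ a ∈ C, X.SameVertex v a := by
  obtain ⟨a, ha⟩ := Set.ncard_eq_one.1 h
  have : a ∈ {d' | X.SameVertex v d' ∧ d' ∈ C} := by rw [ha]; rfl
  exact ⟨a, this.2, this.1⟩

theorem exists_iterate_of_sameVertex {a b : X.Dart} (h : X.SameVertex a b) :
    ∃ n : ℕ, (X.next * X.opp)^[n] a = b := by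
  have hc : (X.next * X.opp).SameCycle a b := by
    induction h with
    | rel x y h =>
      rw [h.2]
      exact (Equiv.Perm.sameCycle_apply_right (f := X.next * X.opp)).2 (.refl _ _)
    | refl => exact .refl _ _
    | symm _ _ _ ih => exact ih.symm
    | trans _ _ _ _ _ ih ih' => exact ih.trans ih'
  obtain ⟨n, hn⟩ := hc.exists_nat_pow_eq
  exact ⟨n, by rw [Equiv.Perm.iterate_eq_pow]; exact hn⟩

/-- Turning around an interior vertex from the edge of `a` to that of `b`: if no edge in between is
crossed by the frontier of `F`, then the corners next to `a` and `b` both lie in `F` or neither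
does. -/
theorem next_opp_mem_iff_of_turn {F : Set X.Dart} {a b : X.Dart} (ha : ¬ X.OnBoundary a)
    (hab : X.SameVertex a b) (hne : a ≠ b)
    (h : ∀ x, X.SameVertex a x → x ≠ a → x ≠ b → (X.next (X.opp x) ∈ F ↔ x ∈ F)) :
    X.next (X.opp a) ∈ F ↔ b ∈ F := by
  classical
  have hex := exists_iterate_of_sameVertex hab
  let σ := X.next * X.opp
  let m := Nat.find hex
  have hm : σ^[m] a = b := Nat.find_spec hex
  have hmin : ∀ i < m, σ^[i] a ≠ b := fun i hi => Nat.find_min hex hi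
  have hm0 : 0 < m := Nat.pos_of_ne_zero fun h0 => hne (by rw [h0] at hm; exact hm)
  have hv : ∀ i, X.SameVertex a (σ^[i] a) := by
    intro i
    induction i with
    | zero => exact .refl _
    | succ i ih =>
      rw [Function.iterate_succ_apply']
      exact ih.trans (sameVertex_next_opp fun ho => ha ⟨_, ho, ih⟩)
  have key : ∀ i, i + 1 ≤ m → (σ^[i + 1] a ∈ F ↔ X.next (X.opp a) ∈ F) := by
    intro i
    induction i with
    | zero => exact fun _ => Iff.rfl
    | succ i ih =>
      intro hi
      rw [← ih (by omega), Function.iterate_succ_apply']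
      refine h _ (hv _) (fun heq => ?_) (hmin _ (by omega))
      refine hmin (m - (i + 1)) (by omega) ?_
      conv_lhs => rw [← heq]
      rw [← Function.iterate_add_apply, Nat.sub_add_cancel (by omega), hm]
  have := key (m - 1) (by omega)
  rw [Nat.sub_add_cancel hm0, hm] at this
  exact this.symm

end MarkedSurface

namespace TangleDiagram

variable {X : MarkedSurface} (T : TangleDiagram X)

/-! ### Crossings and resolutions -/

theorem opp_corner_ne (c : T.Crossing) (i : Fin 4) : X.opp (T.corner c i) ≠ T.corner c i :=
  fun h => T.corner_interior c i ⟨_, h, .refl _⟩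

theorem sameVertex_opp_corner (c : T.Crossing) (i : Fin 4) :
    X.SameVertex (X.opp (T.corner c i)) (T.corner c (i + 1)) := by
  rw [← T.next_corner]
  exact sameVertex_opp_next (T.opp_corner_ne c i)

theorem isCorner_corner (c : T.Crossing) (i : Fin 4) : T.IsCorner (T.corner c i) := ⟨c, i, rfl⟩

theorem not_isCorner_opp_corner (c : T.Crossing) (i : Fin 4) :
    ¬ T.IsCorner (X.opp (T.corner c i)) := by
  rintro ⟨c', j, h⟩
  have h1 := T.sameVertex_opp_corner c i
  rw [h] at h1
  obtain ⟨rfl, rfl⟩ := T.corner_inj _ _ _ _ h1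
  have h2 := T.sameVertex_opp_corner c' (i + 1)
  rw [← h, X.opp_opp] at h2
  have h3 := (T.corner_inj _ _ _ _ h2).2
  revert h3
  fin_cases i <;> decide

theorem isCorner_next_iff {d : X.Dart} : T.IsCorner (X.next d) ↔ T.IsCorner d := by
  constructor
  · rintro ⟨c, i, h⟩
    refine ⟨c, i - 1, X.next.injective ?_⟩
    rw [h, T.next_corner, sub_add_cancel]
  · rintro ⟨c, i, rfl⟩
    exact ⟨c, i + 1, T.next_corner c i⟩

theorem corner_injective {c c' : T.Crossing} {i i' : Fin 4} (h : T.corner c i = T.corner c' i') :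
    c = c' ∧ i = i' :=
  T.corner_inj c i c' i' (h ▸ .refl _)

theorem opp_mem_strand_iff {d : X.Dart} : X.opp d ∈ T.strand ↔ d ∈ T.strand :=
  ⟨fun h => by simpa [X.opp_opp] using T.opp_mem _ h, T.opp_mem d⟩

theorem corner_mem_resolution {S : Finset T.Crossing} {c : T.Crossing} {i : Fin 4} :
    T.corner c i ∈ T.resolution S ↔ (c ∈ S ↔ (i = 0 ∨ i = 2)) := by
  constructor
  · rintro (h | ⟨c', i', h | h, hS⟩)
    · exact (T.corner_notMem c i h).elim
    · obtain ⟨rfl, rfl⟩ := T.corner_injective h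
      exact hS
    · exact (T.not_isCorner_opp_corner c i ⟨c', i', h⟩).elim
  · exact fun h => Or.inr ⟨c, i, Or.inl rfl, h⟩

theorem opp_mem_resolution {S : Finset T.Crossing} {d : X.Dart} :
    X.opp d ∈ T.resolution S ↔ d ∈ T.resolution S := by
  unfold resolution
  refine or_congr T.opp_mem_strand_iff ?_
  simp only [Set.mem_ofPred_eq, X.opp_opp]
  exact exists_congr fun c => exists_congr fun i => and_congr_left fun _ => or_comm

theorem mem_resolution_of_not_isCorner {S : Finset T.Crossing} {d : X.Dart} (h : ¬ T.IsCorner d)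
    (h' : ¬ T.IsCorner (X.opp d)) : d ∈ T.resolution S ↔ d ∈ T.strand := by
  constructor
  · rintro (hd | ⟨c, i, hd | hd, -⟩)
    · exact hd
    · exact (h ⟨c, i, hd⟩).elim
    · exact (h' ⟨c, i, hd⟩).elim
  · exact Or.inl

theorem next_mem_resolution_iff {S : Finset T.Crossing} (c : T.Crossing) (i : Fin 4) :
    T.corner c (i + 1) ∈ T.resolution S ↔ T.corner c i ∉ T.resolution S := by
  rw [corner_mem_resolution, corner_mem_resolution]
  have : (i + 1 = 0 ∨ i + 1 = 2) ↔ ¬ (i = 0 ∨ i = 2) := by revert i; decide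
  tauto

/-- One of the two sides of the quadrilateral that meet in a corner belongs to the resolution, and
so does the one edge of the diagram that ends there. -/
theorem degree_resolution_corner (S : Finset T.Crossing) (c : T.Crossing) (i : Fin 4) :
    X.degree (T.resolution S) (T.corner c i) = 2 := by
  obtain ⟨x, hxS, hxi, hx⟩ : ∃ x, x ∉ T.strand ∧ X.SameVertex (T.corner c i) x ∧
      ∀ y, X.SameVertex (T.corner c i) y → y ∉ T.strand → (y ∈ T.resolution S ↔ y = x) := by
    have hprev := T.sameVertex_opp_corner c (i - 1)
    rw [sub_add_cancel] at hprev
    have hnext := T.next_mem_resolution_iff (S := S) c (i - 1)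
    rw [sub_add_cancel] at hnext
    have hcases : ∀ y, X.SameVertex (T.corner c i) y → y ∉ T.strand → y ∈ T.resolution S →
        y = T.corner c i ∨ y = X.opp (T.corner c (i - 1)) := by
      rintro y hy hyS (h | ⟨c', i', h | h, -⟩)
      · exact (hyS h).elim
      · subst h
        obtain ⟨rfl, rfl⟩ := T.corner_inj _ _ _ _ hy
        exact Or.inl rfl
      · have hyo : y = X.opp (T.corner c' i') := by rw [← h, X.opp_opp]
        obtain ⟨rfl, rfl⟩ :=
          T.corner_inj _ _ _ _ (hy.trans (hyo ▸ T.sameVertex_opp_corner c' i'))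
        exact Or.inr (by rw [hyo, add_sub_cancel_right])
    by_cases h : T.corner c i ∈ T.resolution S
    · refine ⟨_, T.corner_notMem c i, .refl _, fun y hy hyS => ⟨fun hyr => ?_, fun hy => hy ▸ h⟩⟩
      refine (hcases y hy hyS hyr).resolve_right fun hy => hnext.1 h ?_
      rwa [hy, T.opp_mem_resolution] at hyr
    · refine ⟨_, fun h => T.corner_notMem c (i - 1) (T.opp_mem_strand_iff.1 h), hprev.symm,
        fun y hy hyS => ⟨fun hyr => ?_, ?_⟩⟩
      · exact (hcases y hy hyS hyr).resolve_left fun hy => h (hy ▸ hyr)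
      · rintro rfl
        rw [T.opp_mem_resolution]
        exact not_not.1 fun h' => h (hnext.2 h')
  have h1 := T.corner_degree c i
  unfold degree at h1 ⊢
  have hset : {d' | X.SameVertex (T.corner c i) d' ∧ d' ∈ T.resolution S} =
      insert x {d' | X.SameVertex (T.corner c i) d' ∧ d' ∈ T.strand} := by
    ext y
    constructor
    · rintro ⟨hy, hyr⟩
      by_cases hyS : y ∈ T.strand
      · exact Or.inr ⟨hy, hyS⟩
      · exact Or.inl ((hx y hy hyS).1 hyr)
    · rintro (rfl | hy)
      · exact ⟨hxi, (hx y hxi hxS).2 rfl⟩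
      · exact ⟨hy.1, Or.inl hy.2⟩
  rw [hset, Set.ncard_insert_of_notMem fun h => hxS h.2, h1]

theorem degree_resolution_of_not_corner (S : Finset T.Crossing) {v : X.Dart}
    (hv : ∀ c i, ¬ X.SameVertex v (T.corner c i)) :
    X.degree (T.resolution S) v = X.degree T.strand v := by
  unfold degree
  congr 1
  ext y
  refine and_congr_right fun hy => T.mem_resolution_of_not_isCorner ?_ ?_
  · rintro ⟨c, i, rfl⟩
    exact hv c i hy
  · rintro ⟨c, i, h⟩
    have hyo : y = X.opp (T.corner c i) := by rw [← h, X.opp_opp]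
    exact hv c (i + 1) (hy.trans (hyo ▸ T.sameVertex_opp_corner c i))

theorem not_sameVertex_corner_of_boundary {b : X.Dart} (hb : X.opp b = b) (c : T.Crossing)
    (i : Fin 4) : ¬ X.SameVertex b (T.corner c i) :=
  fun h => T.corner_interior c i ⟨b, hb, h.symm⟩

theorem isCurve_resolution (S : Finset T.Crossing) : X.IsCurve (T.resolution S) where
  opp_mem _ h := T.opp_mem_resolution.2 h
  opp_ne d h := by
    rcases h with h | ⟨c, i, rfl | h, -⟩
    · exact T.opp_ne d h
    · exact T.opp_corner_ne c i
    · intro hd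
      exact T.opp_corner_ne c i (by rw [← h, hd, hd])
  interior v hv := by
    by_cases hc : ∃ c i, X.SameVertex v (T.corner c i)
    · obtain ⟨c, i, h⟩ := hc
      rw [degree_congr _ h, degree_resolution_corner]
      exact Or.inr rfl
    · push Not at hc
      rw [T.degree_resolution_of_not_corner S hc]
      exact T.interior v hv hc
  marked b hb := by
    rw [T.degree_resolution_of_not_corner S
      (T.not_sameVertex_corner_of_boundary (X.opp_marked b hb))]
    exact T.marked b hb
  unmarked b hb hbm := by
    rw [T.degree_resolution_of_not_corner S (T.not_sameVertex_corner_of_boundary hb)]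
    exact T.unmarked b hb hbm

section Color

variable {T} {black : Set X.Dart} (hb : T.IsCheckerboard black)

theorem mem_resolutionBlack_of_not_isCorner {S : Finset T.Crossing} {d : X.Dart}
    (h : ¬ T.IsCorner d) : d ∈ T.resolutionBlack black S ↔ d ∈ black := by
  simp [resolutionBlack, h]

include hb

theorem corner_mem_resolutionBlack {S : Finset T.Crossing} {c : T.Crossing} {i : Fin 4} :
    T.corner c i ∈ T.resolutionBlack black S ↔
      ¬ (T.corner c i ∈ black ↔ T.corner c i ∈ T.resolution S) := by
  have h := hb.corner_iff _ (T.isCorner_corner c i)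
  have h' := T.isCorner_corner c i
  simp only [resolutionBlack, Set.mem_ofPred_eq, h, h', true_and]
  tauto

theorem corner_add_one_mem_black {c : T.Crossing} {i : Fin 4} :
    T.corner c (i + 1) ∈ black ↔ T.corner c i ∉ black := by
  rw [← T.next_corner, hb.corner_iff _ (T.isCorner_corner c i)]

theorem corner_mem_black_iff {c : T.Crossing} (i : Fin 4) :
    T.corner c i ∈ black ↔ (T.corner c 0 ∈ black ↔ (i = 0 ∨ i = 2)) := by
  have h1 := corner_add_one_mem_black hb (c := c) (i := 0)
  have h2 := corner_add_one_mem_black hb (c := c) (i := 1)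
  have h3 := corner_add_one_mem_black hb (c := c) (i := 2)
  rw [show (0 : Fin 4) + 1 = 1 from rfl] at h1
  rw [show (1 : Fin 4) + 1 = 2 from rfl] at h2
  rw [show (2 : Fin 4) + 1 = 3 from rfl] at h3
  fin_cases i <;> simp [h1, h2, h3]

theorem opp_corner_mem_black {c : T.Crossing} {i : Fin 4} :
    X.opp (T.corner c i) ∈ black ↔ T.corner c i ∈ black := by
  have h1 := hb.opp_iff _ (T.opp_corner_ne c i)
  have h2 := T.corner_notMem c i
  tauto

theorem faceClosed_resolutionBlack (S : Finset T.Crossing) :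
    FaceClosed (T.resolutionBlack black S) := by
  intro d
  by_cases hd : T.IsCorner d
  · obtain ⟨c, i, rfl⟩ := hd
    rw [T.next_corner, corner_mem_resolutionBlack hb, corner_mem_resolutionBlack hb,
      corner_add_one_mem_black hb, T.next_mem_resolution_iff]
    tauto
  · rw [mem_resolutionBlack_of_not_isCorner hd,
      mem_resolutionBlack_of_not_isCorner fun h => hd (T.isCorner_next_iff.1 h), hb.next_iff d hd]

theorem opp_mem_resolutionBlack_iff (S : Finset T.Crossing) {d : X.Dart} (hd : X.opp d ≠ d) :
    (X.opp d ∈ T.resolutionBlack black S ↔ d ∈ T.resolutionBlack black S) ↔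
      d ∉ T.resolution S := by
  have key : ∀ c i, (X.opp (T.corner c i) ∈ T.resolutionBlack black S ↔
      T.corner c i ∈ T.resolutionBlack black S) ↔ T.corner c i ∉ T.resolution S := by
    intro c i
    rw [mem_resolutionBlack_of_not_isCorner (T.not_isCorner_opp_corner c i),
      corner_mem_resolutionBlack hb, opp_corner_mem_black hb]
    tauto
  by_cases h1 : T.IsCorner d
  · obtain ⟨c, i, rfl⟩ := h1
    exact key c i
  by_cases h2 : T.IsCorner (X.opp d)
  · obtain ⟨c, i, h⟩ := h2
    have hdo : d = X.opp (T.corner c i) := by rw [← h, X.opp_opp]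
    rw [hdo, T.opp_mem_resolution, X.opp_opp, ← key c i]
    exact iff_comm
  · rw [mem_resolutionBlack_of_not_isCorner h1, mem_resolutionBlack_of_not_isCorner h2,
      T.mem_resolution_of_not_isCorner h1 h2, ← hb.opp_iff d hd]
    tauto

theorem State.Essential.wellColored {r : T.State} (hr : r.Essential) :
    (r.colConfig black).WellColored := by
  have hcurve : (r.colConfig black).curve = T.resolution r.ones := by
    ext d
    exact ⟨fun h => h.1, fun h => ⟨h, hr d⟩⟩
  have hC := T.isCurve_resolution r.ones
  have hoff : ∀ d, d ∉ T.resolution r.ones → (X.opp d ∈ T.resolutionBlack black r.ones ↔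
      d ∈ T.resolutionBlack black r.ones) := by
    intro d hd
    by_cases hdd : X.opp d = d
    · rw [hdd]
    · exact (opp_mem_resolutionBlack_iff hb r.ones hdd).2 hd
  refine ⟨hcurve ▸ hC, faceClosed_resolutionBlack hb r.ones, fun d hd => ?_, fun d d' h => ?_⟩
  · rw [hcurve] at hd
    exact hoff d hd
  · rw [hcurve] at h
    by_cases hd : d ∈ T.resolution r.ones
    · have hd' := h.mem_iff.1 hd
      have h1 := opp_mem_resolutionBlack_iff hb r.ones (hC.opp_ne d hd)
      have h2 := opp_mem_resolutionBlack_iff hb r.ones (hC.opp_ne d' hd')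
      exact iff_of_false (fun h => h1.1 h hd) fun h => h2.1 h hd'
    · exact iff_of_true (hoff d hd) (hoff d' fun hd' => hd (h.mem_iff.2 hd'))

omit hb in
theorem iterate_next_corner (c : T.Crossing) (i : Fin 4) :
    X.next^[(i : ℕ)] (T.corner c 0) = T.corner c i := by
  fin_cases i
  · rfl
  all_goals simp [Function.iterate_succ_apply', T.next_corner]

omit hb in
/-- The quadrilateral of a crossing. -/
theorem isPolygon_crossing (c : T.Crossing) :
    IsPolygon (T.corner c 0) 4 {d | ∃ i, d = T.corner c i} where
  face := by
    ext d
    constructor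
    · rintro ⟨i, rfl⟩
      exact ⟨i, i.2, (iterate_next_corner c i).symm⟩
    · rintro ⟨i, hi, rfl⟩
      exact ⟨⟨i, hi⟩, iterate_next_corner c ⟨i, hi⟩⟩
  pos := by norm_num
  closed := by
    have := iterate_next_corner c 3
    change X.next^[3] _ = _ at this
    rw [Function.iterate_succ_apply', this, T.next_corner]
    rfl
  embedded i hi j hj h := by
    have h1 := iterate_next_corner c ⟨i, hi⟩
    have h2 := iterate_next_corner c ⟨j, hj⟩
    dsimp only at h1 h2
    rw [h1, h2] at h
    exact congrArg Fin.val (T.corner_inj _ _ _ _ h).2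
  opp_notMem := by
    rintro _ ⟨i, rfl⟩ ⟨j, h⟩
    exact T.not_isCorner_opp_corner c i ⟨c, j, h⟩

/-- Changing a crossing to its `1`-resolution removes its quadrilateral from the black part or adds
it there. The quadrilateral is attached to the rest along two opposite sides and its four
vertices. -/
theorem euler_resolutionBlack_insert [DecidableEq T.Crossing] {S : Finset T.Crossing}
    {c : T.Crossing} (hc : c ∉ S) :
    (T.corner c 0 ∈ black → X.euler (T.resolutionBlack black (insert c S)) =
      X.euler (T.resolutionBlack black S) + 1) ∧
    (T.corner c 0 ∉ black → X.euler (T.resolutionBlack black (insert c S)) =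
      X.euler (T.resolutionBlack black S) - 1) := by
  classical
  have hP := isPolygon_crossing (T := T) c
  set Q : Set X.Dart := {d | ∃ i, d = T.corner c i} with hQ
  have hF : FaceClosed (T.resolutionBlack black S \ Q) :=
    (faceClosed_resolutionBlack hb S).diff hP.faceClosed
  have hin : ∀ d ∈ Q, (d ∈ T.resolutionBlack black S ↔ T.corner c 0 ∈ black) ∧
      (d ∈ T.resolutionBlack black (insert c S) ↔ T.corner c 0 ∉ black) := by
    rintro _ ⟨i, rfl⟩
    rw [corner_mem_resolutionBlack hb, corner_mem_resolutionBlack hb, corner_mem_resolution,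
      corner_mem_resolution, corner_mem_black_iff hb]
    have : c ∈ insert c S := Finset.mem_insert_self c S
    tauto
  have hout : ∀ d ∉ Q, (d ∈ T.resolutionBlack black (insert c S) ↔
      d ∈ T.resolutionBlack black S) := by
    intro d hd
    by_cases h : T.IsCorner d
    · obtain ⟨c', i, rfl⟩ := h
      have hcc : c' ≠ c := by
        rintro rfl
        exact hd ⟨i, rfl⟩
      rw [corner_mem_resolutionBlack hb, corner_mem_resolutionBlack hb, corner_mem_resolution,
        corner_mem_resolution, Finset.mem_insert, or_iff_right hcc]
    · rw [mem_resolutionBlack_of_not_isCorner h, mem_resolutionBlack_of_not_isCorner h]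
  have hopp : ∀ i, X.opp (T.corner c i) ∈ T.resolutionBlack black S \ Q ↔
      T.corner c i ∈ black := by
    intro i
    rw [Set.mem_sdiff, mem_resolutionBlack_of_not_isCorner (T.not_isCorner_opp_corner c i),
      opp_corner_mem_black hb, and_iff_left]
    exact hP.opp_notMem _ ⟨i, rfl⟩
  have hverts : ∀ i, Quot.mk X.SameVertex (T.corner c i) ∈
      verts (T.resolutionBlack black S \ Q) := by
    intro i
    by_cases h : T.corner c i ∈ black
    · exact hF.mk_mem_verts_of_opp_mem (T.opp_corner_ne c i) ((hopp i).2 h)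
    · have h1 := corner_add_one_mem_black hb (c := c) (i := i - 1)
      have h2 := T.sameVertex_opp_corner c (i - 1)
      rw [sub_add_cancel] at h1 h2
      exact mk_mem_verts.2 ⟨_, (hopp (i - 1)).2 (by tauto), h2⟩
  have hE : X.euler (T.resolutionBlack black S \ Q ∪ Q) =
      X.euler (T.resolutionBlack black S \ Q) - 1 := by
    rw [hP.euler_union hF Set.disjoint_sdiff_left (Finset.range 4)
      (if T.corner c 0 ∈ black then {0, 2} else {1, 3})]
    · split_ifs <;> simp <;> ring
    · intro i
      rw [Finset.mem_range]
      refine ⟨fun hi => ⟨hi, ?_⟩, fun h => h.1⟩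
      rw [iterate_next_corner c ⟨i, hi⟩]
      exact hverts _
    · intro i
      constructor
      · intro hi
        have hi4 : i < 4 := by
          split_ifs at hi <;> simp at hi <;> omega
        refine ⟨hi4, ?_⟩
        rw [iterate_next_corner c ⟨i, hi4⟩, hopp, corner_mem_black_iff hb]
        split_ifs at hi with h <;> simp at hi <;> rcases hi with rfl | rfl <;> simp [h]
      · rintro ⟨hi, hib⟩
        rw [iterate_next_corner c ⟨i, hi⟩, hopp, corner_mem_black_iff hb] at hib
        by_cases h : T.corner c 0 ∈ black <;> interval_cases i <;> simp_all
  constructor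
  · intro h
    have h1 : T.resolutionBlack black S \ Q ∪ Q = T.resolutionBlack black S := by
      ext d
      by_cases hd : d ∈ Q
      · simp [hd, (hin d hd).1, h]
      · simp [hd]
    have h2 : T.resolutionBlack black S \ Q = T.resolutionBlack black (insert c S) := by
      ext d
      by_cases hd : d ∈ Q
      · simp [hd, (hin d hd).2, h]
      · simp [hd, hout d hd]
    rw [h1, h2] at hE
    linarith
  · intro h
    have h1 : T.resolutionBlack black S \ Q ∪ Q = T.resolutionBlack black (insert c S) := by
      ext d
      by_cases hd : d ∈ Q
      · simp [hd, (hin d hd).2, h]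
      · simp [hd, hout d hd]
    have h2 : T.resolutionBlack black S \ Q = T.resolutionBlack black S := by
      ext d
      by_cases hd : d ∈ Q
      · simp [hd, (hin d hd).1, h]
      · simp [hd]
    rw [h1, h2] at hE
    exact hE

end Color

end TangleDiagram

namespace TangleDiagram

variable {X : MarkedSurface} (T : TangleDiagram X)

/-! ### Colours along an alternating diagram -/

theorem eq_of_sameVertex_corner {c : T.Crossing} {i : Fin 4} {a b : X.Dart} (ha : a ∈ T.strand)
    (hb : b ∈ T.strand) (hca : X.SameVertex (T.corner c i) a) (hab : X.SameVertex a b) : a = b :=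
  eq_of_degree_le_one (T.corner_degree c i).le ha hb hca (hca.trans hab)

/-- Away from the crossings, at most two darts of the diagram start at any vertex. -/
theorem eq_or_eq_of_sameVertex {a b x : X.Dart} (ha : a ∈ T.strand) (hb : b ∈ T.strand)
    (hx : x ∈ T.strand) (hne : a ≠ b) (hab : X.SameVertex a b) (hax : X.SameVertex a x) :
    ¬ X.OnBoundary a ∧ (∀ c i, ¬ X.SameVertex a (T.corner c i)) ∧ (x = a ∨ x = b) := by
  have hbd : ¬ X.OnBoundary a := by
    rintro ⟨v, hv, hav⟩
    refine hne (eq_of_degree_le_one (v := v) ?_ ha hb hav.symm (hav.symm.trans hab))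
    by_cases hm : v ∈ X.marked
    · exact (T.marked v hm).le
    · rw [T.unmarked v hv hm]; exact zero_le_one
  have hcor : ∀ c i, ¬ X.SameVertex a (T.corner c i) := fun c i h =>
    hne (T.eq_of_sameVertex_corner ha hb h.symm hab)
  refine ⟨hbd, hcor, ?_⟩
  by_contra! hx'
  have hsub : ({a, b, x} : Set X.Dart) ⊆ {d' | X.SameVertex a d' ∧ d' ∈ T.strand} := by
    rintro y (rfl | rfl | rfl)
    exacts [⟨.refl _, ha⟩, ⟨hab, hb⟩, ⟨hax, hx⟩]
  have := Set.ncard_le_ncard hsub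
  rw [Set.ncard_eq_three.2 ⟨a, b, x, hne, hx'.1.symm, hx'.2.symm, rfl⟩] at this
  have h2 := T.interior a hbd hcor
  unfold degree at h2
  omega

variable {T} {black : Set X.Dart} (hb : T.IsCheckerboard black)
include hb

theorem opp_mem_black_of_mem_strand {d : X.Dart} (hd : d ∈ T.strand) :
    X.opp d ∈ black ↔ d ∉ black :=
  (hb.opp_iff d (T.opp_ne d hd)).2 hd

theorem opp_mem_black_of_notMem_strand {d : X.Dart} (hd : d ∉ T.strand) :
    X.opp d ∈ black ↔ d ∈ black := by
  by_cases hdd : X.opp d = d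
  · rw [hdd]
  · have := hb.opp_iff d hdd
    tauto

/-- The region on the left of an edge that leaves a crossing at vertex `i` of its quadrilateral has
the colour of side `i`. -/
theorem mem_black_iff_corner {c : T.Crossing} {i : Fin 4} {d : X.Dart} (hd : d ∈ T.strand)
    (hdc : X.SameVertex (T.corner c i) d) : d ∈ black ↔ T.corner c i ∈ black := by
  have hprev := T.sameVertex_opp_corner c (i - 1)
  rw [sub_add_cancel] at hprev
  have hnext : X.next (T.corner c (i - 1)) = T.corner c i := by
    rw [T.next_corner, sub_add_cancel]
  have hne : X.opp (T.corner c (i - 1)) ≠ d := fun h =>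
    T.corner_notMem c (i - 1) (T.opp_mem_strand_iff.1 (h ▸ hd))
  have hint : ¬ X.OnBoundary (X.opp (T.corner c (i - 1))) := fun h =>
    T.corner_interior c i (h.of_sameVertex hprev.symm)
  have key := next_opp_mem_iff_of_turn (F := black) hint (hprev.trans hdc) hne ?_
  · rw [X.opp_opp, hnext] at key
    exact key.symm
  · intro x hx hxa hxd
    have hxs : x ∉ T.strand := fun hxs =>
      hxd (T.eq_of_sameVertex_corner hd hxs hdc (hdc.symm.trans (hprev.symm.trans hx))).symm
    rw [hb.next_iff, opp_mem_black_of_notMem_strand hb hxs]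
    rintro ⟨c', j, h⟩
    have hxo : x = X.opp (T.corner c' j) := by rw [← h, X.opp_opp]
    obtain ⟨rfl, rfl⟩ := T.corner_inj _ _ _ _
      (hprev.symm.trans (hx.trans (hxo ▸ T.sameVertex_opp_corner c' j)))
    exact hxa (by rw [hxo, add_sub_cancel_right])

/-- Where an edge of the diagram passes through a vertex, the colours on the left of the two darts
that leave this vertex are different. -/
theorem mem_black_iff_of_sameVertex {a b : X.Dart} (ha : a ∈ T.strand) (hbs : b ∈ T.strand)
    (hne : a ≠ b) (hab : X.SameVertex a b) : b ∈ black ↔ a ∉ black := by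
  obtain ⟨hint, hcor, -⟩ := T.eq_or_eq_of_sameVertex ha hbs ha hne hab (.refl _)
  have hnc : ∀ x, X.SameVertex a x → ¬ T.IsCorner (X.opp x) := by
    rintro x hx ⟨c, i, h⟩
    have hxo : x = X.opp (T.corner c i) := by rw [← h, X.opp_opp]
    exact hcor c (i + 1) (hx.trans (hxo ▸ T.sameVertex_opp_corner c i))
  rw [← next_opp_mem_iff_of_turn (F := black) hint hab hne, hb.next_iff _ (hnc a (.refl _)),
    opp_mem_black_of_mem_strand hb ha]
  intro x hx hxa hxb
  have hxs : x ∉ T.strand := fun hxs =>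
    (T.eq_or_eq_of_sameVertex ha hbs hxs hne hab hx).2.2.elim hxa hxb
  rw [hb.next_iff _ (hnc x hx), opp_mem_black_of_notMem_strand hb hxs]

/-- The two darts that leave crossings at the ends of an edge of the diagram point in opposite
directions, so that the colours on their left are different. -/
theorem mem_black_iff_of_sameComp {c c' : T.Crossing} {i i' : Fin 4} {y z : X.Dart}
    (hne : (c, i) ≠ (c', i')) (hy : y ∈ T.strand) (hz : z ∈ T.strand)
    (hyc : X.SameVertex (T.corner c i) y) (hzc : X.SameVertex (T.corner c' i') z)
    (h : X.SameComp T.strand y z) : z ∈ black ↔ y ∉ black := by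
  -- The darts that are met when the edge is followed in the direction of `y`.
  let R : X.Dart → X.Dart → Prop := fun a b =>
    a ∈ T.strand ∧ b ∈ T.strand ∧ X.opp a ≠ b ∧ X.SameVertex (X.opp a) b
  have hcol : ∀ x, ReflTransGen R y x → (x ∈ black ↔ y ∈ black) := by
    intro x hx
    induction hx with
    | refl => rfl
    | tail _ h ih =>
      obtain ⟨ha, hb', hne, hab⟩ := h
      rw [mem_black_iff_of_sameVertex hb (T.opp_mem _ ha) hb' hne hab,
        opp_mem_black_of_mem_strand hb ha, not_not, ih]
  have hstep : ∀ a b, a ∈ T.strand → b ∈ T.strand → (b = X.opp a ∨ X.SameVertex a b) →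
      (ReflTransGen R y a ∨ ReflTransGen R y (X.opp a)) →
      (ReflTransGen R y b ∨ ReflTransGen R y (X.opp b)) := by
    rintro a b ha hb' (rfl | hab) hW
    · rw [X.opp_opp]; exact hW.symm
    by_cases hne' : a = b
    · exact hne' ▸ hW
    rcases hW with hW | hW
    · rcases ReflTransGen.cases_tail hW with rfl | ⟨w, hw, hwa⟩
      · exact (hne' (T.eq_of_sameVertex_corner ha hb' hyc hab)).elim
      · obtain ⟨hws, -, hne, hv⟩ := hwa
        have hbw := (T.eq_or_eq_of_sameVertex (T.opp_mem _ hws) ha hb' hne hv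
          (hv.trans hab)).2.2.resolve_right (Ne.symm hne')
        rw [hbw, X.opp_opp]
        exact Or.inr hw
    · refine Or.inl (hW.tail ⟨T.opp_mem _ ha, hb', ?_, ?_⟩) <;> rw [X.opp_opp] <;> assumption
  have hinv : ∀ a b, X.SameComp T.strand a b →
      ((ReflTransGen R y a ∨ ReflTransGen R y (X.opp a)) ↔
      (ReflTransGen R y b ∨ ReflTransGen R y (X.opp b))) := by
    intro a b hab
    induction hab with
    | rel a b hab =>
      refine ⟨hstep a b hab.1 hab.2.1 hab.2.2, hstep b a hab.2.1 hab.1 ?_⟩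
      exact hab.2.2.imp (fun h => by rw [h, X.opp_opp]) fun h => h.symm
    | refl => rfl
    | symm _ _ _ ih => exact ih.symm
    | trans _ _ _ _ _ ih ih' => exact ih.trans ih'
  rcases (hinv y z h).1 (Or.inl .refl) with hW | hW
  · rcases ReflTransGen.cases_tail hW with rfl | ⟨w, -, hws, -, hne', hv⟩
    · obtain ⟨rfl, rfl⟩ := T.corner_inj _ _ _ _ (hyc.trans hzc.symm)
      exact (hne rfl).elim
    · exact (hne' (T.eq_of_sameVertex_corner hz (T.opp_mem _ hws) hzc hv.symm).symm).elim
  · rw [← hcol _ hW, opp_mem_black_of_mem_strand hb hz, not_not]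

theorem corner_mem_black_iff_of_sameComp (halt : T.Alternating) {c c' : T.Crossing} {i i' : Fin 4}
    {y z : X.Dart} (hy : y ∈ T.strand) (hz : z ∈ T.strand)
    (hyc : X.SameVertex (T.corner c i) y) (hzc : X.SameVertex (T.corner c' i') z)
    (h : X.SameComp T.strand y z) : T.corner c 0 ∈ black ↔ T.corner c' 0 ∈ black := by
  by_cases hne : (c, i) = (c', i')
  · rw [(Prod.mk.inj hne).1]
  have h1 := mem_black_iff_of_sameComp hb hne hy hz hyc hzc h
  rw [mem_black_iff_corner hb hy hyc, mem_black_iff_corner hb hz hzc, corner_mem_black_iff hb i,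
    corner_mem_black_iff hb i'] at h1
  have h2 := halt c i c' i' y z hne hy hz hyc.symm hzc.symm h
  tauto

/-- In a connected alternating diagram, the regions that are swept out by turning the overcrossing
strands counterclockwise all have the same colour. -/
theorem corner_mem_black_iff_corner (hconn : T.Connected) (halt : T.Alternating)
    (c c' : T.Crossing) : T.corner c 0 ∈ black ↔ T.corner c' 0 ∈ black := by
  -- The edges of the diagram at the vertex of `x` lead only to crossings of the same kind as `c`.
  let Good : X.Dart → Prop := fun x => ∀ y ∈ T.strand, X.SameVertex x y → ∀ c' i', ∀ z ∈ T.strand,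
    X.SameVertex (T.corner c' i') z → X.SameComp T.strand y z →
      (T.corner c 0 ∈ black ↔ T.corner c' 0 ∈ black)
  have hcorner : ∀ c' i', (T.corner c 0 ∈ black ↔ T.corner c' 0 ∈ black) →
      Good (T.corner c' i') := fun c' i' h y hy hyc c'' i'' z hz hzc hyz =>
    h.trans (corner_mem_black_iff_of_sameComp hb halt hy hz hyc hzc hyz)
  have hcorner' : ∀ c' i', Good (T.corner c' i') →
      (T.corner c 0 ∈ black ↔ T.corner c' 0 ∈ black) := by
    intro c' i' h
    obtain ⟨y, hy, hyc⟩ := exists_of_degree_eq_one (T.corner_degree c' i')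
    exact h y hy hyc c' i' y hy hyc (EqvGen.refl _)
  have hvertex : ∀ a b, X.SameVertex a b → (Good a ↔ Good b) := fun a b hab =>
    ⟨fun h y hy hby => h y hy (hab.trans hby), fun h y hy hay => h y hy (hab.symm.trans hay)⟩
  have hopp : ∀ a ∈ T.strand, Good a → Good (X.opp a) := by
    intro a ha h y hy hay c' i' z hz hzc hyz
    have hao := T.opp_mem a ha
    exact h a ha (.refl _) c' i' z hz hzc
      (((SameComp.of_opp ha hao).trans (.of_sameVertex hay hao hy)).trans hyz)
  have hinv : ∀ a b, EqvGen (fun a b => (a ∈ T.strand ∧ b = X.opp a) ∨ X.SameVertex a b ∨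
      ∃ c i j, a = T.corner c i ∧ b = T.corner c j) a b → (Good a ↔ Good b) := by
    intro a b hab
    induction hab with
    | rel a b hab =>
      rcases hab with ⟨ha, rfl⟩ | hab | ⟨c', i, j, rfl, rfl⟩
      · refine ⟨hopp a ha, fun h => ?_⟩
        have := hopp _ (T.opp_mem a ha) h
        rwa [X.opp_opp] at this
      · exact hvertex a b hab
      · exact ⟨fun h => hcorner _ _ (hcorner' _ _ h), fun h => hcorner _ _ (hcorner' _ _ h)⟩
    | refl => rfl
    | symm _ _ _ ih => exact ih.symm
    | trans _ _ _ _ _ ih ih' => exact ih.trans ih'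
  obtain ⟨y, hy, hyc⟩ := exists_of_degree_eq_one (T.corner_degree c 0)
  obtain ⟨z, hz, hzc⟩ := exists_of_degree_eq_one (T.corner_degree c' 0)
  exact hcorner' c' 0 ((hvertex _ _ hzc).2 ((hinv y z (hconn y hy z hz)).1
    ((hvertex _ _ hyc).1 (hcorner c 0 Iff.rfl))))

/-! ### The homological grading -/

/-- In a connected alternating diagram, the Euler characteristic of the black part of a resolution
is an affine function of the number of `1`-resolved crossings, with slope `1` or `-1`. -/
theorem exists_euler_resolutionBlack_eq (hconn : T.Connected) (halt : T.Alternating) :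
    ∃ ε : ℤ, ε ≠ 0 ∧ ∀ S : Finset T.Crossing,
      X.euler (T.resolutionBlack black S) = X.euler (T.resolutionBlack black ∅) + ε * S.card := by
  classical
  obtain ⟨ε, hε, h⟩ : ∃ ε : ℤ, ε ≠ 0 ∧ ∀ (c : T.Crossing) (S : Finset T.Crossing), c ∉ S →
      X.euler (T.resolutionBlack black (insert c S)) =
        X.euler (T.resolutionBlack black S) + ε := by
    by_cases hc : ∃ c : T.Crossing, T.corner c 0 ∈ black
    · obtain ⟨c₀, h₀⟩ := hc
      exact ⟨1, one_ne_zero, fun c S hcS => (euler_resolutionBlack_insert hb hcS).1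
        ((corner_mem_black_iff_corner hb hconn halt c₀ c).1 h₀)⟩
    · push Not at hc
      refine ⟨-1, by norm_num, fun c S hcS => ?_⟩
      rw [(euler_resolutionBlack_insert hb hcS).2 (hc c)]
      ring
  refine ⟨ε, hε, fun S => ?_⟩
  induction S using Finset.induction_on with
  | empty => simp
  | insert c S hcS ih =>
    rw [h c S hcS, ih, Finset.card_insert_of_notMem hcS]
    push_cast
    ring

theorem State.HasColoredGlyph.euler_eq {r : T.State} (hr : r.Essential) {bc : ColoredGlyph X}
    (h : r.HasColoredGlyph black bc) : X.euler (T.resolutionBlack black r.ones) = bc.euler := by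
  obtain ⟨g, hg, -, hv, rfl⟩ := h
  exact ((State.Essential.wellColored hb hr).euler_eq_of_reflTransGen hg).symm

/-- States without contractible circles that have the same coloured glyph have the same number of
`1`-resolved crossings. -/
theorem card_ones_eq (hconn : T.Connected) (halt : T.Alternating) {bc : ColoredGlyph X}
    {r r' : T.State} (hr : r.Essential) (hr' : r'.Essential) (h : r.HasColoredGlyph black bc)
    (h' : r'.HasColoredGlyph black bc) : r.ones.card = r'.ones.card := by
  obtain ⟨ε, hε, he⟩ := exists_euler_resolutionBlack_eq hb hconn halt
  have h1 := (h.euler_eq hb hr).trans (h'.euler_eq hb hr').symm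
  rw [he, he r'.ones] at h1
  exact_mod_cast mul_left_cancel₀ hε (add_left_cancel h1)

omit hb

theorem Flip.card_eq {c : T.Crossing} {r t : T.State} (h : T.Flip c r t) :
    t.ones.card = r.ones.card + 1 := by
  classical
  have : t.ones = insert c r.ones := by
    apply Finset.coe_injective
    rw [h.2.1, Finset.coe_insert]
  rw [this, Finset.card_insert_of_notMem h.1]

theorem pairing_eq_zero {r r' : T.State} (h : r'.ones.card ≠ r.ones.card + 2) :
    T.pairing r r' = 0 := by
  refine finsum_mem_eq_zero_of_forall_eq_zero fun t ht => (h ?_).elim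
  obtain ⟨⟨c, c', h1, h2⟩, -⟩ := ht
  rw [h2.card_eq, h1.card_eq]

theorem boundary_eq_zero {bc : ColoredGlyph X} {i : ℤ}
    (h : ∀ j, j ≠ i → Subsingleton (T.CT black bc j)) (j k : ℤ) :
    T.boundary black bc j k = 0 := by
  by_cases hj : j = i
  · by_cases hk : k = i
    · subst hj
      subst hk
      have hsum : ∀ r : T.Gen black bc k,
          ∑ r' : T.Gen black bc k, T.pairing r.1 r'.1 • T.basisElt r' = 0 := by
        refine fun r => Finset.sum_eq_zero fun r' _ => ?_
        rw [pairing_eq_zero, zero_smul]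
        have h1 := r.2.2.1
        have h2 := r'.2.2.1
        omega
      simp only [boundary, hsum]
      exact Finsupp.linearCombination_zero _ _ _
    · have := h k hk
      exact LinearMap.ext fun x => Subsingleton.elim _ _
  · have := h j hj
    exact LinearMap.ext fun x => by rw [Subsingleton.elim x 0, map_zero, map_zero]

end TangleDiagram

theorem mainTheorem3 (X : MarkedSurface) (T : TangleDiagram X)
    (hconn : T.Connected) (halt : T.Alternating)
    (black : Set X.Dart) (hblack : T.IsCheckerboard black)
    (o : T.Orientation) (bc : ColoredGlyph X) :
    ∃ i : ℤ,
      (∀ j, j ≠ i → Subsingleton (T.CT black bc j)) ∧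
      (∀ j k, T.boundary black bc j k = 0) ∧
      (∀ j, Nonempty (o.HT black bc j ≃ₗ[T.CoeffField] o.CT black bc j)) ∧
      (∀ j, j ≠ i - o.nPlus → Subsingleton (o.HT black bc j)) := by
  obtain ⟨i, hi⟩ : ∃ i : ℤ, ∀ j, j ≠ i → Subsingleton (T.CT black bc j) := by
    by_cases h : ∃ i : ℤ, Nonempty (T.Gen black bc i)
    · obtain ⟨i, ⟨r⟩⟩ := h
      refine ⟨i, fun j hj => ?_⟩
      have : IsEmpty (T.Gen black bc j) := ⟨fun r' => hj <| by
        rw [← r.2.2.1, ← r'.2.2.1, TangleDiagram.card_ones_eq hblack hconn halt r.2.1 r'.2.1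
          r.2.2.2 r'.2.2.2]⟩
      exact inferInstanceAs (Subsingleton (T.Gen black bc j →₀ T.CoeffField))
    · refine ⟨0, fun j _ => ?_⟩
      have : IsEmpty (T.Gen black bc j) := ⟨fun r => h ⟨j, ⟨r⟩⟩⟩
      exact inferInstanceAs (Subsingleton (T.Gen black bc j →₀ T.CoeffField))
  have hzero := TangleDiagram.boundary_eq_zero hi
  refine ⟨i, hi, hzero, fun j => ?_, fun j hj => ?_⟩
  · -- The cycles are everything and the boundaries vanish.
    refine ⟨(Submodule.quotEquivOfEqBot _ ?_).trans (LinearEquiv.ofTop _ ?_)⟩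
    · rw [hzero (j + o.nPlus - 2), LinearMap.range_zero, Submodule.submoduleOf, Submodule.comap_bot,
        Submodule.ker_subtype]
    · rw [hzero, LinearMap.ker_zero]
  · have := hi (j + o.nPlus) (by omega)
    infer_instance
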